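/- **Setting.** Let $C,A_1,\dots,A_m\in\mathbb S^n$ and $b\in\mathbb R^m$. Consider the semidefinite program (P): minimize $\langle C,X\rangle$ subject to $\langle A_i,X\rangle=b_i$ $(1\le i\le m)$, $X\succeq 0$; and its dual (D): maximize $b^{\mathsf T}y$ subject to $Z+\sum_i y_iA_i=C$, $Z\succeq0$. Assume that the $A_i$ are linearly independent, that (P) and (D) are both strictly feasible, and that strict complementarity holds: there are a primal optimal $X^\star$ and a dual optimal $(y^\star,Z^\star)$ with $\operatorname{rank}X^\star+\operatorname{rank}Z^\star=n$. Let $\mathcal P^\star$ be the set of optimal solutions of (P), $\mathcal X_0=\{X\in\mathbb S^n:\langle A_i,X\rangle=b_i\ \forall i\}$, $\mathcal A(X)=(\langle A_i,X\rangle)_i$, $\mathcal A^*(y)=\sum_i y_iA_i$, let $\|\cdot\|$ be the Frobenius norm, and $\lambda_1\ge\lambda_2\ge\dots\ge\lambda_n$ the ordered eigenvalues of a symmetric matrix. Let $$F(X)=\langle C,X\rangle+\rho\max\{\lambda_{1}(-X),0\},\qquad \rho>\max\{\operatorname{tr}Z^\star:(y^\star,Z^\star)\text{ dual optimal}\},$$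 $$\sigma_{\mathrm p}=\max_{X^\star\in\mathcal P^\star}\dim\operatorname{null}(X^\star),\qquad \delta=\inf_{X^\star\in\mathcal P^\star}\ \sup_{1\le r\le\sigma_{\mathrm p}}\bigl(\lambda_r(-X^\star)-\lambda_{r+1}(-X^\star)\bigr),$$ where $\delta:=0$ if $\sigma_{\mathrm p}=0$, and $\lambda_{n+1}:=0$. **Algorithm.** Let $r_{\mathrm p}\ge0$, $r_{\mathrm c}\ge1$, $r=r_{\mathrm p}+r_{\mathrm c}<n$, $\alpha>0$, $\beta\in(0,1)$, $\Omega_0\in\mathbb S^n$. For $\bar W\in\mathbb S^n$ and $P\in\mathbb R^{n\times r}$ put $$\hat F_{(\bar W,P)}(X)=\langle C,X\rangle+\rho\max_{S\succeq0,\ \gamma\ge0,\ \gamma+\operatorname{tr}S\le1}\langle\gamma\bar W+PSP^{\mathsf T},-X\rangle .$$ Start with any $\bar W_0\succeq0$, $\operatorname{tr}\bar W_0=1$, and with $P_0$ whose columns are orthonormal eigenvectors for the $r$ largest eigenvalues of $-\Omega_0$; put $X_0^\star=\Omega_0$. At iteration $t\ge 0$: 1. Let $X_{t+1}^\star$ minimize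 $\hat F_{(\bar W_t,P_t)}(X)+\frac\alpha2\|X-\Omega_t\|^2$ over $\mathcal X_0$. Let $W_t^\star=\gamma_t^\star\bar W_t+P_tS_t^\star P_t^{\mathsf T}$ (with $S_t^\star\succeq0$, $\gamma^\star_t\ge0$, $\gamma_t^\star+\operatorname{tr}S_t^\star\le\rho$) together with $y_t^\star$ minimize the dual form of this problem, $\langle W-C,\Omega_t\rangle-\langle b-\mathcal A(\Omega_t),y\rangle+\frac1{2\alpha}\|W-C+\mathcal A^*(y)\|^2$, over all $y\in\mathbb R^m$ and all $W$ of the form $\gamma\bar W_t+P_tSP_t^{\mathsf T}$ with $S\succeq0$, $\gamma\ge0$, $\gamma+\operatorname{tr}S\le\rho$. 2. If $t=0$ and $\Omega_0\notin\mathcal X_0$, put $\Omega_1=X_1^\star$. Otherwise put $\Omega_{t+1}=X^\star_{t+1}$ (descent step) if $\beta\bigl(F(\Omega_t)-\hat F_{(\bar W_t,P_t)}(X_{t+1}^\star)\bigr)\le F(\Omega_t)-F(X^\star_{t+1})$, and $\Omega_{t+1}=\Omega_t$ (null step) if not. 3. Let $V_t$ have as columns orthonormal eigenvectors for the $r_{\mathrm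 c}$ largest eigenvalues of $-X_{t+1}^\star$. Let $[Q_1\ Q_2]$ be an orthogonal matrix of eigenvectors of $S_t^\star$, eigenvalues in decreasing order, $Q_1$ consisting of the first $r_{\mathrm p}$ columns, and let $\Sigma_2$ be the diagonal matrix of the last $r_{\mathrm c}$ eigenvalues. Let $P_{t+1}\in\mathbb R^{n\times r}$ have orthonormal columns whose span contains the columns of $V_t$ and of $P_tQ_1$. Put $\bar W_{t+1}=(\gamma^\star_t\bar W_t+P_tQ_2\Sigma_2Q_2^{\mathsf T}P_t^{\mathsf T})/(\gamma_t^\star+\operatorname{tr}\Sigma_2)$; if the denominator is $0$, take any $\bar W_{t+1}\succeq0$ with $\operatorname{tr}\bar W_{t+1}=1$. All choices left open are arbitrary; a sequence so produced is called a run. **Lemma.** There is a constant $\eta>0$, depending only on the problem data and $\rho$, with the following properties. (a) If $\delta>0$, then $$\eta=4\rho\max\Bigl\{\frac{144\,\sup_{X^\star\in\mathcal P^\star}\|X^\star\|_{\mathrm{op}}}{\delta^2},\ \frac{9(8\sqrt2+16)}{\delta}\Bigr\};$$ and $\delta>0$ whenever $C\notin\operatorname{span}\{A_1,\dots,A_m\}$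 and $\sigma_{\mathrm p}<n$. (b) For all $r_{\mathrm p},r_{\mathrm c},\alpha,\beta,\Omega_0$ as above with $r_{\mathrm c}\ge\sigma_{\mathrm p}$ there is $T_0\ge1$ such that for every run and every $t\ge T_0$: - if $\delta>0$, then $\|\Omega_t-X^\star\|_{\mathrm{op}}\le\delta/3$ for some $X^\star\in\mathcal P^\star$; - $\hat F_{(\bar W_t,P_t)}(X)\le F(X)$ for all $X\in\mathcal X_0$; - if $\alpha\ge\eta$ and $\beta\le\frac12$, or if $\Omega_t=X_t^\star$ (for instance, if iteration $t-1$ was a descent step), then $$F(X)\le\hat F_{(\bar W_t,P_t)}(X)+\frac\eta2\|X-\Omega_t\|^2\qquad\text{for all }X\in\mathcal X_0 .$$ -/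

import Mathlib

open Matrix

noncomputable section

namespace SBMP

/-- Trace inner product of real matrices. -/
def innerF {p q : ℕ} (M N : Matrix (Fin p) (Fin q) ℝ) : ℝ := (Mᵀ * N).trace

/-- Squared Frobenius norm. -/
def normSqF {p q : ℕ} (M : Matrix (Fin p) (Fin q) ℝ) : ℝ := innerF M M

/-- Operator (spectral) norm, induced by the Euclidean norm. -/
def opNorm {p : ℕ} (M : Matrix (Fin p) (Fin p) ℝ) : ℝ :=
  ‖Matrix.toEuclideanCLM (n := Fin p) (𝕜 := ℝ) M‖

/-- `lam M k` is the `k`-th largest eigenvalue (counted from `1`, with multiplicity) of a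
symmetric matrix `M` of size `p`; the value is only meaningful for `1 ≤ k ≤ p`. -/
def lam {p : ℕ} (M : Matrix (Fin p) (Fin p) ℝ) (k : ℕ) : ℝ :=
  open Classical in
  if h : M.IsHermitian ∧ 1 ≤ k ∧ k ≤ p then
    h.1.eigenvalues₀ ⟨k - 1, by rw [Fintype.card_fin]; omega⟩
  else 0

/-- The columns of `V` are orthonormal eigenvectors of `M` for its `k` largest eigenvalues,
in decreasing order. -/
def IsTopEigenvectors {p k : ℕ} (M : Matrix (Fin p) (Fin p) ℝ)
    (V : Matrix (Fin p) (Fin k) ℝ) : Prop :=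
  Vᵀ * V = 1 ∧ M * V = V * Matrix.diagonal (fun j : Fin k => lam M ((j : ℕ) + 1))

/-- Data of a standard-form semidefinite program: minimize `⟨C, X⟩` subject to
`⟨A i, X⟩ = b i` and `X ⪰ 0`. -/
structure SDP (n m : ℕ) where
  C : Matrix (Fin n) (Fin n) ℝ
  A : Fin m → Matrix (Fin n) (Fin n) ℝ
  b : Fin m → ℝ
  C_symm : C.IsSymm
  A_symm : ∀ i, (A i).IsSymm

namespace SDP

variable {n m : ℕ} (D : SDP n m)

/-- The affine set of symmetric matrices with `⟨A i, X⟩ = b i` for all `i`. -/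
def affineSet : Set (Matrix (Fin n) (Fin n) ℝ) :=
  {X | X.IsSymm ∧ ∀ i, innerF (D.A i) X = D.b i}

/-- The adjoint map `y ↦ ∑ i, y i • A i`. -/
def adj (y : Fin m → ℝ) : Matrix (Fin n) (Fin n) ℝ := ∑ i, y i • D.A i

/-- Primal optimal solutions. -/
def primalOpt : Set (Matrix (Fin n) (Fin n) ℝ) :=
  {X | (X ∈ D.affineSet ∧ X.PosSemidef) ∧
    ∀ X' ∈ D.affineSet, X'.PosSemidef → innerF D.C X ≤ innerF D.C X'}

/-- Dual optimal solutions: maximize `bᵀ y` subject to `Z + ∑ i, y i • A i = C`, `Z ⪰ 0`. -/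
def dualOpt : Set ((Fin m → ℝ) × Matrix (Fin n) (Fin n) ℝ) :=
  {p | (p.2 + D.adj p.1 = D.C ∧ p.2.PosSemidef) ∧
    ∀ (y' : Fin m → ℝ) (Z' : Matrix (Fin n) (Fin n) ℝ),
      Z' + D.adj y' = D.C → Z'.PosSemidef → D.b ⬝ᵥ y' ≤ D.b ⬝ᵥ p.1}

/-- Both the primal and the dual program are strictly feasible. -/
def Slater : Prop :=
  (∃ X ∈ D.affineSet, X.PosDef) ∧
    ∃ (y : Fin m → ℝ) (Z : Matrix (Fin n) (Fin n) ℝ), Z + D.adj y = D.C ∧ Z.PosDef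

/-- Some pair of primal and dual optimal solutions satisfies `rank X + rank Z = n`. -/
def StrictComplementarity : Prop :=
  ∃ X ∈ D.primalOpt, ∃ p ∈ D.dualOpt, X.rank + p.2.rank = n

/-- The largest trace of a dual optimal `Z`. -/
def dualTraceMax : ℝ := sSup ((fun p => p.2.trace) '' D.dualOpt)

/-- `σ_p`: the largest dimension of the null space of a primal optimal solution. -/
def sigmaP : ℕ :=
  sSup ((fun X : Matrix (Fin n) (Fin n) ℝ =>
    Module.finrank ℝ (LinearMap.ker X.mulVecLin)) '' D.primalOpt)

/-- The eigenvalue gap parameter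
`inf_{X ∈ P*} sup_{1 ≤ r ≤ σ_p} (λ_r(-X) - λ_{r+1}(-X))`. -/
def gap : ℝ :=
  sInf ((fun X => sSup ((fun r : ℕ => lam (-X) r - lam (-X) (r + 1)) '' Set.Icc 1 D.sigmaP))
    '' D.primalOpt)

/-- The largest operator norm of a primal optimal solution. -/
def primalOpMax : ℝ := sSup (opNorm '' D.primalOpt)

/-- The explicit constant `4 ρ max {144 sup ‖X*‖_op / δ², 9 (8 √2 + 16) / δ}`. -/
def etaConst (ρ : ℝ) : ℝ :=
  4 * ρ * max (144 * D.primalOpMax / D.gap ^ 2) (9 * (8 * Real.sqrt 2 + 16) / D.gap)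

/-- The penalized cost `F(X) = ⟨C, X⟩ + ρ max {λ_max(-X), 0}`. -/
def F (ρ : ℝ) (X : Matrix (Fin n) (Fin n) ℝ) : ℝ :=
  innerF D.C X + ρ * max (lam (-X) 1) 0

/-- `{γ W̄ + P S Pᵀ | S ⪰ 0, γ ≥ 0, γ + tr S ≤ τ}`. -/
def weightSet {r : ℕ} (τ : ℝ) (Wbar : Matrix (Fin n) (Fin n) ℝ)
    (P : Matrix (Fin n) (Fin r) ℝ) : Set (Matrix (Fin n) (Fin n) ℝ) :=
  {W | ∃ (γ : ℝ) (S : Matrix (Fin r) (Fin r) ℝ),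
    S.PosSemidef ∧ 0 ≤ γ ∧ γ + S.trace ≤ τ ∧ W = γ • Wbar + P * S * Pᵀ}

/-- The spectral lower model
`⟨C, X⟩ + ρ max {⟨γ W̄ + P S Pᵀ, -X⟩ | S ⪰ 0, γ ≥ 0, γ + tr S ≤ 1}`. -/
def model {r : ℕ} (ρ : ℝ) (Wbar : Matrix (Fin n) (Fin n) ℝ) (P : Matrix (Fin n) (Fin r) ℝ)
    (X : Matrix (Fin n) (Fin n) ℝ) : ℝ :=
  innerF D.C X + ρ * sSup ((fun W => innerF W (-X)) '' weightSet 1 Wbar P)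

/-- Objective of the regularized master problem in `X`, with proximal center `Om`. -/
def masterObj {r : ℕ} (ρ α : ℝ) (Wbar : Matrix (Fin n) (Fin n) ℝ)
    (P : Matrix (Fin n) (Fin r) ℝ) (Om X : Matrix (Fin n) (Fin n) ℝ) : ℝ :=
  D.model ρ Wbar P X + α / 2 * normSqF (X - Om)

/-- Objective of the dual form of the master problem in `(W, y)`, to be minimized over
`W ∈ weightSet ρ W̄ P` and `y`. -/
def dualMasterObj (α : ℝ) (Om W : Matrix (Fin n) (Fin n) ℝ) (y : Fin m → ℝ) : ℝ :=
  innerF (W - D.C) Om - (fun i => D.b i - innerF (D.A i) Om) ⬝ᵥ y +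
    1 / (2 * α) * normSqF (W - D.C + D.adj y)

/-- An (infinite) execution of the spectral bundle method for the primal program, with penalty
`ρ`, proximal weight `α`, descent parameter `β`, `rp` past and `rc` current eigenvectors, and
starting point `Om0`. All choices the method leaves open (the initial weight, orthonormal bases
of eigenvectors, minimizers that are not unique) are arbitrary. -/
structure Run (ρ α β : ℝ) (rp rc : ℕ) (Om0 : Matrix (Fin n) (Fin n) ℝ) where
  /-- reference points (proximal centers) `Ω_t` -/
  Om : ℕ → Matrix (Fin n) (Fin n) ℝ
  /-- candidates `X_t*`: `cand (t + 1)` is computed at iteration `t`; `cand 0 = Ω_0` -/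
  cand : ℕ → Matrix (Fin n) (Fin n) ℝ
  /-- weight matrices `W̄_t` -/
  Wbar : ℕ → Matrix (Fin n) (Fin n) ℝ
  /-- orthonormal matrices `P_t` -/
  P : ℕ → Matrix (Fin n) (Fin (rp + rc)) ℝ
  /-- master solutions `γ_t*`, `S_t*`, `y_t*` -/
  γ : ℕ → ℝ
  S : ℕ → Matrix (Fin (rp + rc)) (Fin (rp + rc)) ℝ
  y : ℕ → Fin m → ℝ
  /-- `Q_t = [Q_1 Q_2]` of the eigenvalue decomposition of `S_t*` -/
  Q : ℕ → Matrix (Fin (rp + rc)) (Fin (rp + rc)) ℝ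
  /-- top `rc` eigenvectors `V_t` of `-X_{t+1}*` -/
  V : ℕ → Matrix (Fin n) (Fin rc) ℝ
  Om_zero : Om 0 = Om0
  cand_zero : cand 0 = Om0
  P_zero : IsTopEigenvectors (-Om0) (P 0)
  Wbar_zero : (Wbar 0).PosSemidef ∧ (Wbar 0).trace = 1
  /-- `X_{t+1}*` solves the master problem -/
  cand_opt : ∀ t, IsMinOn (D.masterObj ρ α (Wbar t) (P t) (Om t)) D.affineSet (cand (t + 1))
  cand_mem : ∀ t, cand (t + 1) ∈ D.affineSet
  /-- `(γ_t*, S_t*)` is feasible and, with `y_t*`, solves the dual form of the master problem -/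
  S_psd : ∀ t, (S t).PosSemidef
  γ_nonneg : ∀ t, 0 ≤ γ t
  coeff_le : ∀ t, γ t + (S t).trace ≤ ρ
  dual_opt : ∀ t, ∀ W ∈ weightSet ρ (Wbar t) (P t), ∀ y' : Fin m → ℝ,
    D.dualMasterObj α (Om t) (γ t • Wbar t + P t * S t * (P t)ᵀ) (y t) ≤
      D.dualMasterObj α (Om t) W y'
  /-- the first reference point is replaced if it violates the affine constraint -/
  step_affine : Om 0 ∉ D.affineSet → Om 1 = cand 1
  /-- descent step -/
  step_descent : ∀ t, (t ≠ 0 ∨ Om 0 ∈ D.affineSet) →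
    β * (D.F ρ (Om t) - D.model ρ (Wbar t) (P t) (cand (t + 1))) ≤
      D.F ρ (Om t) - D.F ρ (cand (t + 1)) → Om (t + 1) = cand (t + 1)
  /-- null step -/
  step_null : ∀ t, (t ≠ 0 ∨ Om 0 ∈ D.affineSet) →
    ¬ β * (D.F ρ (Om t) - D.model ρ (Wbar t) (P t) (cand (t + 1))) ≤
      D.F ρ (Om t) - D.F ρ (cand (t + 1)) → Om (t + 1) = Om t
  Q_eig : ∀ t, IsTopEigenvectors (S t) (Q t)
  V_eig : ∀ t, IsTopEigenvectors (-cand (t + 1)) (V t)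
  /-- `P_{t+1}` has orthonormal columns whose span contains those of `V_t` and `P_t Q_1` -/
  P_orth : ∀ t, (P (t + 1))ᵀ * P (t + 1) = 1
  P_span_current : ∀ t,
    LinearMap.range (V t).mulVecLin ≤ LinearMap.range (P (t + 1)).mulVecLin
  P_span_past : ∀ t,
    LinearMap.range (P t * (Q t).submatrix id (Fin.castAdd rc)).mulVecLin ≤
      LinearMap.range (P (t + 1)).mulVecLin
  /-- `W̄_{t+1} = (γ W̄_t + P_t Q_2 Σ_2 Q_2ᵀ P_tᵀ) / (γ + tr Σ_2)` -/
  Wbar_succ : ∀ t, γ t + (∑ j : Fin rc, lam (S t) (rp + (j : ℕ) + 1)) ≠ 0 →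
    Wbar (t + 1) = (γ t + ∑ j : Fin rc, lam (S t) (rp + (j : ℕ) + 1))⁻¹ •
      (γ t • Wbar t + P t * ((Q t).submatrix id (Fin.natAdd rp) *
        Matrix.diagonal (fun j : Fin rc => lam (S t) (rp + (j : ℕ) + 1)) *
        ((Q t).submatrix id (Fin.natAdd rp))ᵀ) * (P t)ᵀ)
  /-- if nothing is left to aggregate, the next weight is any admissible one -/
  Wbar_succ_zero : ∀ t, γ t + (∑ j : Fin rc, lam (S t) (rp + (j : ℕ) + 1)) = 0 →
    (Wbar (t + 1)).PosSemidef ∧ (Wbar (t + 1)).trace = 1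

end SDP

end SBMP

end

/-! The penalty is exact: since `ρ` exceeds every dual trace, `F` on the affine set has the primal
optimal value as its minimum and the primal optimal set as its set of minimizers, and its sublevel
sets are compact. Three facts then combine.

Convergence, uniform over runs (`exists_forall_F_le`). Away from the optimum, a descent step lowers
`F` by a fixed amount. A null step raises the value of the proximal master problem by a fixed
amount, because the next model contains both the old aggregate and a cut active at the rejected
candidate. Neither amount depends on the run, so one index `T0` serves all runs. By compactness,
from then on every reference point lies within a prescribed distance of the optimal set.

Quadratic closeness (`F_le_model_add`). Suppose the model contains top eigenvectors `V` of `-Om`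
with a gap `g` below `max (lam (-Om) 1) 0`. Split a top eigenvector of `-X` along the range of `V`
and its complement. The model controls the first block, the gap makes the second block smaller, and
the off-diagonal block comes only from `Om - X`. Completing a square bounds the error by `ρ * (4 /
g) * ‖X - Om‖²`. Near the optimal set such a gap exists at index `σ_p + 1`: it is `D.gap` if that is
positive, and otherwise comes from compactness and the negativity of that eigenvalue on the optimal
set.

Persistence (`isAnchored_of_le`). Right after the reference point is replaced, the model contains
the required eigenvectors. If `η ≤ α` and `β ≤ 1 / 2`, the quadratic bound itself forces the next
step to be a descent step, so this situation reproduces itself forever. -/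

namespace SBMP

/-! ### Trace inner product and Frobenius norm. -/

section InnerF
variable {p q : ℕ}

theorem innerF_eq_sum (M N : Matrix (Fin p) (Fin q) ℝ) :
    innerF M N = ∑ x : Fin p × Fin q, M x.1 x.2 * N x.1 x.2 := by
  rw [Fintype.sum_prod_type, Finset.sum_comm]
  simp [innerF, Matrix.trace, Matrix.mul_apply]

theorem innerF_comm (M N : Matrix (Fin p) (Fin q) ℝ) : innerF M N = innerF N M := by
  simp [innerF_eq_sum, mul_comm]

theorem innerF_add_left (M N K : Matrix (Fin p) (Fin q) ℝ) :
    innerF (M + N) K = innerF M K + innerF N K := by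
  simp [innerF, Matrix.add_mul]

theorem innerF_add_right (K M N : Matrix (Fin p) (Fin q) ℝ) :
    innerF K (M + N) = innerF K M + innerF K N := by
  simp [innerF, Matrix.mul_add]

theorem innerF_smul_left (c : ℝ) (M N : Matrix (Fin p) (Fin q) ℝ) :
    innerF (c • M) N = c * innerF M N := by
  simp [innerF]

theorem innerF_smul_right (c : ℝ) (M N : Matrix (Fin p) (Fin q) ℝ) :
    innerF M (c • N) = c * innerF M N := by
  simp [innerF]

theorem innerF_neg_left (M N : Matrix (Fin p) (Fin q) ℝ) : innerF (-M) N = -innerF M N := by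
  simp [innerF]

theorem innerF_neg_right (M N : Matrix (Fin p) (Fin q) ℝ) : innerF M (-N) = -innerF M N := by
  simp [innerF]

theorem innerF_sub_left (M N K : Matrix (Fin p) (Fin q) ℝ) :
    innerF (M - N) K = innerF M K - innerF N K := by
  simp [innerF, Matrix.sub_mul]

theorem innerF_sub_right (K M N : Matrix (Fin p) (Fin q) ℝ) :
    innerF K (M - N) = innerF K M - innerF K N := by
  simp [innerF, Matrix.mul_sub]

@[simp] theorem innerF_zero_left (N : Matrix (Fin p) (Fin q) ℝ) : innerF 0 N = 0 := by
  simp [innerF]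

@[simp] theorem innerF_zero_right (N : Matrix (Fin p) (Fin q) ℝ) : innerF N 0 = 0 := by
  simp [innerF]

theorem innerF_sum_left {ι : Type*} (s : Finset ι) (f : ι → Matrix (Fin p) (Fin q) ℝ)
    (N : Matrix (Fin p) (Fin q) ℝ) : innerF (∑ i ∈ s, f i) N = ∑ i ∈ s, innerF (f i) N := by
  simp [innerF, Matrix.transpose_sum, Matrix.sum_mul, Matrix.trace_sum]

theorem innerF_one_right (M : Matrix (Fin p) (Fin p) ℝ) : innerF M 1 = M.trace := by
  simp [innerF]

theorem innerF_vecMulVec (u : Fin p → ℝ) (v : Fin q → ℝ) (M : Matrix (Fin p) (Fin q) ℝ) :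
    innerF (vecMulVec u v) M = u ⬝ᵥ M *ᵥ v := by
  rw [innerF_eq_sum, Fintype.sum_prod_type]
  simp only [vecMulVec_apply, dotProduct, mulVec, Finset.mul_sum]
  exact Finset.sum_congr rfl fun i _ => Finset.sum_congr rfl fun j _ => by ring

theorem innerF_transpose (M N : Matrix (Fin p) (Fin q) ℝ) : innerF Mᵀ Nᵀ = innerF M N := by
  simp only [innerF_eq_sum, Fintype.sum_prod_type, transpose_apply]
  exact Finset.sum_comm

/-- Frobenius norm. -/
noncomputable def normF (M : Matrix (Fin p) (Fin q) ℝ) : ℝ := Real.sqrt (normSqF M)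

theorem normSqF_nonneg (M : Matrix (Fin p) (Fin q) ℝ) : 0 ≤ normSqF M := by
  rw [normSqF, innerF_eq_sum]
  exact Finset.sum_nonneg fun _ _ => mul_self_nonneg _

theorem normF_nonneg (M : Matrix (Fin p) (Fin q) ℝ) : 0 ≤ normF M := Real.sqrt_nonneg _

theorem normF_sq (M : Matrix (Fin p) (Fin q) ℝ) : normF M ^ 2 = normSqF M :=
  Real.sq_sqrt (normSqF_nonneg M)

theorem normSqF_add (M N : Matrix (Fin p) (Fin q) ℝ) :
    normSqF (M + N) = normSqF M + 2 * innerF M N + normSqF N := by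
  simp only [normSqF, innerF_add_left, innerF_add_right, innerF_comm N M]; ring

theorem normSqF_smul (c : ℝ) (M : Matrix (Fin p) (Fin q) ℝ) :
    normSqF (c • M) = c ^ 2 * normSqF M := by
  simp only [normSqF, innerF_smul_left, innerF_smul_right]; ring

theorem normSqF_neg (M : Matrix (Fin p) (Fin q) ℝ) : normSqF (-M) = normSqF M := by
  simp [normSqF, innerF_neg_left, innerF_neg_right]

theorem normF_neg (M : Matrix (Fin p) (Fin q) ℝ) : normF (-M) = normF M := by
  simp [normF, normSqF_neg]

theorem normF_smul (c : ℝ) (M : Matrix (Fin p) (Fin q) ℝ) : normF (c • M) = |c| * normF M := by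
  rw [normF, normSqF_smul, Real.sqrt_mul (sq_nonneg c), Real.sqrt_sq_eq_abs, normF]

theorem normF_sub_comm (M N : Matrix (Fin p) (Fin q) ℝ) : normF (M - N) = normF (N - M) := by
  rw [← normF_neg, neg_sub]

@[simp] theorem normF_zero : normF (0 : Matrix (Fin p) (Fin q) ℝ) = 0 := by
  simp [normF, normSqF]

theorem normSqF_eq_zero {M : Matrix (Fin p) (Fin q) ℝ} (h : normSqF M = 0) : M = 0 := by
  rw [normSqF, innerF_eq_sum, Finset.sum_eq_zero_iff_of_nonneg fun _ _ => mul_self_nonneg _] at h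
  ext i j
  simpa using h (i, j) (Finset.mem_univ _)

/-- Cauchy-Schwarz for the trace inner product. -/
theorem abs_innerF_le (M N : Matrix (Fin p) (Fin q) ℝ) : |innerF M N| ≤ normF M * normF N := by
  rw [normF, normF, ← Real.sqrt_mul (normSqF_nonneg M)]
  apply Real.abs_le_sqrt
  simp only [normSqF, innerF_eq_sum, ← pow_two]
  exact Finset.sum_mul_sq_le_sq_mul_sq _ _ _

theorem innerF_le (M N : Matrix (Fin p) (Fin q) ℝ) : innerF M N ≤ normF M * normF N :=
  (le_abs_self _).trans (abs_innerF_le M N)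

theorem normF_add_le (M N : Matrix (Fin p) (Fin q) ℝ) : normF (M + N) ≤ normF M + normF N := by
  apply abs_le_of_sq_le_sq' _ (add_nonneg (normF_nonneg M) (normF_nonneg N)) |>.2
  rw [normF_sq, normSqF_add, ← normF_sq M, ← normF_sq N]
  nlinarith [innerF_le M N]

theorem abs_entry_le (M : Matrix (Fin p) (Fin q) ℝ) (i : Fin p) (j : Fin q) :
    |M i j| ≤ normF M := by
  apply Real.abs_le_sqrt
  rw [normSqF, innerF_eq_sum, pow_two]
  exact Finset.single_le_sum (f := fun x : Fin p × Fin q => M x.1 x.2 * M x.1 x.2)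
    (fun _ _ => mul_self_nonneg _) (Finset.mem_univ (i, j))

theorem normSqF_vecMulVec (u : Fin p → ℝ) (v : Fin q → ℝ) :
    normSqF (vecMulVec u v) = (u ⬝ᵥ u) * (v ⬝ᵥ v) := by
  rw [normSqF, innerF_vecMulVec, vecMulVec_mulVec]
  simp [dotProduct_smul, mul_comm]

theorem abs_dotProduct_mulVec_le (u : Fin p → ℝ) (v : Fin q → ℝ) (M : Matrix (Fin p) (Fin q) ℝ) :
    |u ⬝ᵥ M *ᵥ v| ≤ normF M * (Real.sqrt (u ⬝ᵥ u) * Real.sqrt (v ⬝ᵥ v)) := by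
  rw [← innerF_vecMulVec, mul_comm]
  refine (abs_innerF_le _ _).trans_eq ?_
  rw [normF, normSqF_vecMulVec, Real.sqrt_mul (by simpa using dotProduct_star_self_nonneg u)]

theorem dotProduct_self_nonneg (u : Fin p → ℝ) : 0 ≤ u ⬝ᵥ u := by
  simpa using dotProduct_star_self_nonneg u

theorem abs_rayleigh_le (u : Fin p → ℝ) (M : Matrix (Fin p) (Fin p) ℝ) :
    |u ⬝ᵥ M *ᵥ u| ≤ normF M * (u ⬝ᵥ u) := by
  simpa [Real.mul_self_sqrt (dotProduct_self_nonneg u)] using abs_dotProduct_mulVec_le u u M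

theorem continuous_innerF :
    Continuous fun x : Matrix (Fin p) (Fin q) ℝ × Matrix (Fin p) (Fin q) ℝ => innerF x.1 x.2 := by
  simp only [innerF]
  fun_prop

theorem continuous_normF : Continuous (normF : Matrix (Fin p) (Fin q) ℝ → ℝ) := by
  unfold normF normSqF
  exact Real.continuous_sqrt.comp (continuous_innerF.comp (continuous_id.prodMk continuous_id))

theorem opNorm_le_normF (M : Matrix (Fin p) (Fin p) ℝ) : opNorm M ≤ normF M := by
  refine ContinuousLinearMap.opNorm_le_bound _ (normF_nonneg M) fun x => ?_
  have h1 : ‖x‖ = Real.sqrt (x.ofLp ⬝ᵥ x.ofLp) := by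
    rw [EuclideanSpace.norm_eq]; congr 1
    simp [dotProduct, pow_two]
  set z := (Matrix.toEuclideanCLM (n := Fin p) (𝕜 := ℝ) M) x with hz
  have hz' : z.ofLp = M *ᵥ x.ofLp := by simp [hz]
  have h2 : ‖z‖ = Real.sqrt (z.ofLp ⬝ᵥ z.ofLp) := by
    rw [EuclideanSpace.norm_eq]; congr 1
    simp [dotProduct, pow_two]
  -- With `z = M x` this reads `‖z‖² ≤ normF M * ‖z‖ * ‖x‖`; dividing by `‖z‖` gives the bound.
  have h3 := abs_dotProduct_mulVec_le z.ofLp x.ofLp M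
  rw [← hz', ← h1, ← h2, abs_of_nonneg (dotProduct_self_nonneg _)] at h3
  have h4 : z.ofLp ⬝ᵥ z.ofLp = ‖z‖ * ‖z‖ := by
    rw [h2, Real.mul_self_sqrt (dotProduct_self_nonneg _)]
  rcases (norm_nonneg z).eq_or_lt with h | h
  · rw [← h]; exact mul_nonneg (normF_nonneg M) (norm_nonneg x)
  · rw [h4] at h3
    exact le_of_mul_le_mul_left (by linarith) h

/-- Bridges Frobenius-Lipschitz estimates and the entrywise topology in which the compactness
arguments take place. -/
theorem continuousOn_of_abs_sub_le {f : Matrix (Fin p) (Fin q) ℝ → ℝ} {L : ℝ}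
    {s : Set (Matrix (Fin p) (Fin q) ℝ)}
    (h : ∀ X ∈ s, ∀ Y ∈ s, |f X - f Y| ≤ L * normF (X - Y)) : ContinuousOn f s := by
  intro X hX
  have h1 : Filter.Tendsto (fun Y => L * normF (Y - X)) (nhdsWithin X s) (nhds 0) := by
    have : Continuous fun Y => L * normF (Y - X) :=
      continuous_const.mul (continuous_normF.comp (continuous_id.sub continuous_const))
    simpa using (this.tendsto X).mono_left nhdsWithin_le_nhds
  refine tendsto_iff_dist_tendsto_zero.2
    (squeeze_zero' (Filter.Eventually.of_forall fun _ => dist_nonneg) ?_ h1)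
  filter_upwards [self_mem_nhdsWithin] with Y hY
  exact h Y hY X hX

end InnerF

/-! ### Ordered eigenvalues: Courant-Fischer, Weyl, and trace inequalities. -/

section Spectral
variable {p k : ℕ} {M : Matrix (Fin p) (Fin p) ℝ}

theorem isHermitian_iff_isSymm : M.IsHermitian ↔ M.IsSymm := by
  simp [Matrix.IsHermitian, Matrix.IsSymm, conjTranspose_eq_transpose_of_trivial]

theorem posSemidef_iff : M.PosSemidef ↔ M.IsSymm ∧ ∀ x : Fin p → ℝ, 0 ≤ x ⬝ᵥ M *ᵥ x := by
  rw [posSemidef_iff_dotProduct_mulVec, isHermitian_iff_isSymm]; simp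

theorem posDef_iff : M.PosDef ↔ M.IsSymm ∧ ∀ x : Fin p → ℝ, x ≠ 0 → 0 < x ⬝ᵥ M *ᵥ x := by
  rw [posDef_iff_dotProduct_mulVec, isHermitian_iff_isSymm]; simp

theorem dotProduct_self_pos {x : Fin p → ℝ} (hx : x ≠ 0) : 0 < x ⬝ᵥ x :=
  (dotProduct_self_nonneg x).lt_of_ne fun h => hx (dotProduct_self_eq_zero.1 h.symm)

theorem dotProduct_mulVec_comm (hM : M.IsSymm) (x y : Fin p → ℝ) :
    x ⬝ᵥ M *ᵥ y = y ⬝ᵥ M *ᵥ x := by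
  rw [dotProduct_mulVec, ← mulVec_transpose, hM, dotProduct_comm]

theorem exists_isTopEigenvectors (hM : M.IsSymm) :
    ∃ U : Matrix (Fin p) (Fin p) ℝ, IsTopEigenvectors M U := by
  have h := isHermitian_iff_isSymm.2 hM
  -- Reindexes the eigenvector basis so that column `j` belongs to the sorted eigenvalue of index `j
  -- + 1`.
  let e : Fin p ≃ Fin p :=
    (finCongr (Fintype.card_fin p).symm).trans (Fintype.equivOfCardEq (Fintype.card_fin _))
  have he : ∀ j, h.eigenvalues (e j) = lam M ((j : ℕ) + 1) := by
    intro j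
    rw [lam, dif_pos ⟨h, by omega, by omega⟩, Matrix.IsHermitian.eigenvalues]
    congr 1
    simp only [e, Equiv.trans_apply, Equiv.symm_apply_apply]
    ext; simp
  refine ⟨Matrix.of fun i j => h.eigenvectorBasis (e j) i, ?_, ?_⟩
  · ext i j
    have := orthonormal_iff_ite.1 h.eigenvectorBasis.orthonormal (e i) (e j)
    simp only [PiLp.inner_apply, RCLike.inner_apply, conj_trivial, EmbeddingLike.apply_eq_iff_eq]
      at this
    simp only [Matrix.mul_apply, transpose_apply, of_apply, Matrix.one_apply]
    rw [← this]
    exact Finset.sum_congr rfl fun _ _ => mul_comm _ _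
  · ext i j
    have := congrFun (h.mulVec_eigenvectorBasis (e j)) i
    rw [he] at this
    simp only [mul_diagonal, of_apply]
    rw [mul_comm]
    simpa [Matrix.mul_apply, mulVec, dotProduct] using this

theorem lam_antitone (hM : M.IsSymm) {i j : ℕ} (hij : i ≤ j) (hj : j < p) :
    lam M (j + 1) ≤ lam M (i + 1) := by
  have h := isHermitian_iff_isSymm.2 hM
  rw [lam, lam, dif_pos ⟨h, by omega, by omega⟩, dif_pos ⟨h, by omega, by omega⟩]
  exact h.eigenvalues₀_antitone (by simpa using hij)

namespace IsTopEigenvectors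
variable {V : Matrix (Fin p) (Fin k) ℝ} {U : Matrix (Fin p) (Fin p) ℝ}

theorem dotProduct_mulVec (hV : IsTopEigenvectors M V) (a b : Fin k → ℝ) :
    (V *ᵥ a) ⬝ᵥ (V *ᵥ b) = a ⬝ᵥ b := by
  rw [dotProduct_comm, Matrix.dotProduct_mulVec, ← mulVec_transpose, mulVec_mulVec, hV.1,
    one_mulVec, dotProduct_comm]

theorem mulVec_mulVec (hV : IsTopEigenvectors M V) (a : Fin k → ℝ) :
    M *ᵥ (V *ᵥ a) = V *ᵥ (fun j => lam M ((j : ℕ) + 1) * a j) := by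
  rw [Matrix.mulVec_mulVec, hV.2, ← Matrix.mulVec_mulVec]
  congr 1; ext j; simp [mulVec_diagonal]

theorem rayleigh (hV : IsTopEigenvectors M V) (a : Fin k → ℝ) :
    (V *ᵥ a) ⬝ᵥ M *ᵥ (V *ᵥ a) = ∑ j : Fin k, lam M ((j : ℕ) + 1) * a j ^ 2 := by
  rw [hV.mulVec_mulVec, hV.dotProduct_mulVec]
  exact Finset.sum_congr rfl fun j _ => by ring

theorem mul_transpose (hU : IsTopEigenvectors M U) : U * Uᵀ = 1 :=
  mul_eq_one_comm.1 hU.1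

theorem exists_coeff (hU : IsTopEigenvectors M U) (x : Fin p → ℝ) : U *ᵥ (Uᵀ *ᵥ x) = x := by
  rw [Matrix.mulVec_mulVec, hU.mul_transpose, one_mulVec]

end IsTopEigenvectors

theorem rayleigh_le_of_orthogonal {U : Matrix (Fin p) (Fin p) ℝ} (hM : M.IsSymm)
    (hU : IsTopEigenvectors M U) {k : ℕ} {x : Fin p → ℝ}
    (hx : ∀ i : Fin p, (i : ℕ) < k → (Uᵀ *ᵥ x) i = 0) :
    x ⬝ᵥ M *ᵥ x ≤ lam M (k + 1) * (x ⬝ᵥ x) := by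
  set a := Uᵀ *ᵥ x with ha
  rw [← hU.exists_coeff x, ← ha, hU.rayleigh, hU.dotProduct_mulVec, dotProduct, Finset.mul_sum]
  refine Finset.sum_le_sum fun i _ => ?_
  by_cases hi : (i : ℕ) < k
  · simp [hx i hi]
  · rw [← pow_two]
    exact mul_le_mul_of_nonneg_right (lam_antitone hM (not_lt.1 hi) i.2) (sq_nonneg (a i))

theorem rayleigh_le_lam_one (hM : M.IsSymm) (x : Fin p → ℝ) :
    x ⬝ᵥ M *ᵥ x ≤ lam M 1 * (x ⬝ᵥ x) := by
  rcases Nat.eq_zero_or_pos p with rfl | hp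
  · simp [dotProduct]
  obtain ⟨U, hU⟩ := exists_isTopEigenvectors hM
  exact rayleigh_le_of_orthogonal hM hU (x := x) (k := 0) (by simp)

/-- One half of the Courant-Fischer principle. -/
theorem lt_lam_of_forall_rayleigh (hM : M.IsSymm) {k : ℕ} (hk : k < p) {c : ℝ}
    (T : (Fin (k + 1) → ℝ) →ₗ[ℝ] (Fin p → ℝ))
    (hT : ∀ a, a ≠ 0 → c * (T a ⬝ᵥ T a) < T a ⬝ᵥ M *ᵥ T a) : c < lam M (k + 1) := by
  by_contra! hc
  obtain ⟨U, hU⟩ := exists_isTopEigenvectors hM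
  -- Orthogonality to the top `k` eigenvectors is `k` equations in `k + 1` unknowns, so some nonzero
  -- `a` satisfies them all.
  let L : (Fin (k + 1) → ℝ) →ₗ[ℝ] (Fin k → ℝ) :=
    (LinearMap.funLeft ℝ ℝ (Fin.castLE hk.le)) ∘ₗ (Uᵀ).mulVecLin ∘ₗ T
  obtain ⟨a, ha, ha0⟩ : ∃ a ∈ LinearMap.ker L, a ≠ 0 := by
    have : LinearMap.ker L ≠ ⊥ := LinearMap.ker_ne_bot_of_finrank_lt (by simp)
    exact Submodule.exists_mem_ne_zero_of_ne_bot this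
  have h1 := rayleigh_le_of_orthogonal hM hU (x := T a) fun i hi => by
    have := congrFun (LinearMap.mem_ker.1 ha) ⟨i, hi⟩
    exact this
  have h2 := hT a ha0
  have h3 := mul_le_mul_of_nonneg_right hc (dotProduct_self_nonneg (T a))
  linarith

/-- The first `k` of a family of top eigenvectors. -/
theorem IsTopEigenvectors.castLE {k' : ℕ} (h : k' ≤ k) {V : Matrix (Fin p) (Fin k) ℝ}
    (hV : IsTopEigenvectors M V) : IsTopEigenvectors M (V.submatrix id (Fin.castLE h)) := by
  refine ⟨?_, ?_⟩
  · ext i j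
    have := congrFun (congrFun hV.1 (Fin.castLE h i)) (Fin.castLE h j)
    simpa [Matrix.mul_apply, Matrix.one_apply] using this
  · ext i j
    have := congrFun (congrFun hV.2 i) (Fin.castLE h j)
    rw [mul_diagonal] at this ⊢
    simpa [Matrix.mul_apply] using this

/-- Weyl's perturbation inequality. -/
theorem lam_le_add {N : Matrix (Fin p) (Fin p) ℝ} (hM : M.IsSymm) (hN : N.IsSymm) {k : ℕ}
    (hk : k < p) : lam M (k + 1) ≤ lam N (k + 1) + normF (M - N) := by
  rw [← sub_le_iff_le_add]
  refine le_of_forall_lt fun c hc => ?_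
  obtain ⟨U, hU⟩ := exists_isTopEigenvectors hM
  have hV := hU.castLE (k' := k + 1) hk
  set V := U.submatrix id (Fin.castLE (n := k + 1) hk)
  -- The span of the top `k + 1` eigenvectors of `M` serves as the test space for `N`.
  refine lt_lam_of_forall_rayleigh hN hk V.mulVecLin fun a ha => ?_
  simp only [mulVecLin_apply]
  have h1 : lam M (k + 1) * (a ⬝ᵥ a) ≤ (V *ᵥ a) ⬝ᵥ M *ᵥ (V *ᵥ a) := by
    rw [hV.rayleigh, dotProduct, Finset.mul_sum]
    refine Finset.sum_le_sum fun i _ => ?_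
    rw [← pow_two]
    exact mul_le_mul_of_nonneg_right (lam_antitone hM (Nat.lt_succ_iff.1 i.2) hk) (sq_nonneg (a i))
  have h2 := abs_le.1 (abs_rayleigh_le (V *ᵥ a) (M - N))
  rw [sub_mulVec, dotProduct_sub, hV.dotProduct_mulVec] at h2
  rw [hV.dotProduct_mulVec]
  have h3 := mul_lt_mul_of_pos_right hc (dotProduct_self_pos ha)
  linarith [h2.2]

theorem abs_lam_sub_le {N : Matrix (Fin p) (Fin p) ℝ} (hM : M.IsSymm) (hN : N.IsSymm) {k : ℕ}
    (hk : k < p) : |lam M (k + 1) - lam N (k + 1)| ≤ normF (M - N) := by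
  rw [abs_sub_le_iff]
  have h1 := lam_le_add hM hN hk
  have h2 := lam_le_add hN hM hk
  rw [normF_sub_comm] at h2
  constructor <;> linarith

/-- On the orthogonal complement of top eigenvectors the quadratic form is bounded by the next
eigenvalue. -/
theorem IsTopEigenvectors.rayleigh_le_of_orthogonal {V : Matrix (Fin p) (Fin k) ℝ}
    (hV : IsTopEigenvectors M V) (hM : M.IsSymm) (hk : k < p) {w : Fin p → ℝ}
    (hw : Vᵀ *ᵥ w = 0) : w ⬝ᵥ M *ᵥ w ≤ lam M (k + 1) * (w ⬝ᵥ w) := by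
  by_contra! hlt
  have hw0 : w ≠ 0 := by rintro rfl; simp at hlt
  set c := lam M (k + 1)
  -- With `j` minimal, the first `j` eigenvalues exceed `c` strictly. Those eigenvectors together
  -- with `w` then span a test space of dimension `j + 1` on which the Rayleigh quotient exceeds
  -- `c`, contradicting `lam M (j + 1) ≤ c`.
  obtain ⟨j, hj, hjk, hjlt⟩ : ∃ j, lam M (j + 1) ≤ c ∧ j ≤ k ∧ ∀ i < j, c < lam M (i + 1) := by
    classical
    have hex : ∃ j, lam M (j + 1) ≤ c := ⟨k, le_rfl⟩
    exact ⟨Nat.find hex, Nat.find_spec hex, Nat.find_min' hex le_rfl,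
      fun i hi => not_le.1 (Nat.find_min hex hi)⟩
  have hV' := hV.castLE hjk
  set V' := V.submatrix id (Fin.castLE hjk) with hV'def
  have hVw : V'ᵀ *ᵥ w = 0 := by
    ext i
    have := congrFun hw (Fin.castLE hjk i)
    simpa [mulVec, dotProduct, hV'def] using this
  have horth : ∀ a, (V' *ᵥ a) ⬝ᵥ w = 0 := fun a => by
    rw [dotProduct_comm, Matrix.dotProduct_mulVec, ← mulVec_transpose, hVw, zero_dotProduct]
  let T : (Fin (j + 1) → ℝ) →ₗ[ℝ] (Fin p → ℝ) :=
    V'.mulVecLin ∘ₗ LinearMap.funLeft ℝ ℝ Fin.castSucc +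
      (LinearMap.proj (Fin.last j)).smulRight w
  have hT : ∀ a, T a = V' *ᵥ (fun i => a i.castSucc) + a (Fin.last j) • w := fun a => rfl
  refine absurd (lt_lam_of_forall_rayleigh hM (by omega) T (c := c) fun a ha => ?_) (not_lt.2 hj)
  rw [hT]
  set b : Fin j → ℝ := fun i => a i.castSucc with hb
  set s := a (Fin.last j)
  have h1 : (V' *ᵥ b + s • w) ⬝ᵥ (V' *ᵥ b + s • w) = b ⬝ᵥ b + s ^ 2 * (w ⬝ᵥ w) := by
    simp only [add_dotProduct, dotProduct_add, smul_dotProduct, dotProduct_smul, horth,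
      hV'.dotProduct_mulVec, dotProduct_comm w (V' *ᵥ b), smul_eq_mul]
    ring
  have h2 : (V' *ᵥ b + s • w) ⬝ᵥ M *ᵥ (V' *ᵥ b + s • w) =
      ∑ i : Fin j, lam M ((i : ℕ) + 1) * b i ^ 2 + s ^ 2 * (w ⬝ᵥ M *ᵥ w) := by
    have h3 : w ⬝ᵥ M *ᵥ (V' *ᵥ b) = 0 := by
      rw [hV'.mulVec_mulVec, dotProduct_comm, horth]
    simp only [mulVec_add, mulVec_smul, add_dotProduct, dotProduct_add, smul_dotProduct,
      dotProduct_smul, dotProduct_mulVec_comm hM (V' *ᵥ b) w, h3, hV'.rayleigh, smul_eq_mul]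
    ring
  rw [h1, h2, mul_add, dotProduct, Finset.mul_sum]
  have h4 : ∀ i : Fin j, c * (b i * b i) ≤ lam M ((i : ℕ) + 1) * b i ^ 2 := fun i => by
    rw [← pow_two]
    exact mul_le_mul_of_nonneg_right (hjlt i i.2).le (sq_nonneg _)
  by_cases hs : s = 0
  · have : ∃ i, b i ≠ 0 := by
      by_contra! hall
      apply ha
      ext i
      refine Fin.lastCases hs (fun i => hall i) i
    obtain ⟨i, hi⟩ := this
    have := Finset.sum_lt_sum (fun i _ => h4 i) ⟨i, Finset.mem_univ i, by
      rw [← pow_two]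
      exact mul_lt_mul_of_pos_right (hjlt i i.2) (by positivity)⟩
    simpa [hs] using this
  · have h5 := Finset.sum_le_sum (s := Finset.univ) fun i _ => h4 i
    have h6 : c * (s ^ 2 * (w ⬝ᵥ w)) < s ^ 2 * (w ⬝ᵥ M *ᵥ w) := by
      have := mul_lt_mul_of_pos_left hlt (show 0 < s ^ 2 by positivity)
      linarith
    linarith

theorem innerF_eq_sum_lam {U N : Matrix (Fin p) (Fin p) ℝ} (hU : IsTopEigenvectors M U) :
    innerF M N = ∑ j : Fin p, lam M ((j : ℕ) + 1) * (U.col j ⬝ᵥ N *ᵥ U.col j) := by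
  have hMU : M = ∑ j : Fin p, lam M ((j : ℕ) + 1) • vecMulVec (U.col j) (U.col j) := by
    have h : M = U * diagonal (fun j : Fin p => lam M ((j : ℕ) + 1)) * Uᵀ := by
      rw [← hU.2, Matrix.mul_assoc, hU.mul_transpose, Matrix.mul_one]
    conv_lhs => rw [h]
    ext a b
    rw [Matrix.mul_apply, Matrix.sum_apply]
    refine Finset.sum_congr rfl fun j _ => ?_
    simp [vecMulVec_apply, mul_diagonal]
    ring
  conv_lhs => rw [hMU]
  rw [innerF_sum_left]
  simp only [innerF_smul_left, innerF_vecMulVec]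

theorem IsTopEigenvectors.col_dotProduct {V : Matrix (Fin p) (Fin k) ℝ}
    (hV : IsTopEigenvectors M V) (j : Fin k) : V.col j ⬝ᵥ V.col j = 1 := by
  have := congrFun (congrFun hV.1 j) j
  simpa [Matrix.mul_apply, dotProduct] using this

theorem IsTopEigenvectors.mulVec_col {V : Matrix (Fin p) (Fin k) ℝ}
    (hV : IsTopEigenvectors M V) (j : Fin k) : M *ᵥ V.col j = lam M ((j : ℕ) + 1) • V.col j := by
  ext i
  have := congrFun (congrFun hV.2 i) j
  rw [mul_diagonal] at this
  simpa [Matrix.mul_apply, mulVec, dotProduct, mul_comm] using this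

theorem IsTopEigenvectors.lam_eq {V : Matrix (Fin p) (Fin k) ℝ}
    (hV : IsTopEigenvectors M V) (j : Fin k) :
    V.col j ⬝ᵥ M *ᵥ V.col j = lam M ((j : ℕ) + 1) := by
  rw [hV.mulVec_col, dotProduct_smul, hV.col_dotProduct, smul_eq_mul, mul_one]

theorem IsTopEigenvectors.lam_nonneg {V : Matrix (Fin p) (Fin k) ℝ}
    (hV : IsTopEigenvectors M V) (hM : M.PosSemidef) (j : Fin k) : 0 ≤ lam M ((j : ℕ) + 1) := by
  rw [← hV.lam_eq]
  exact (posSemidef_iff.1 hM).2 _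

/-- The inner product of a positive semidefinite matrix with a matrix whose quadratic form is at
most `c`. -/
theorem innerF_le_of_rayleigh_le {W N : Matrix (Fin p) (Fin p) ℝ} (hW : W.PosSemidef) {c : ℝ}
    (hN : ∀ x : Fin p → ℝ, x ⬝ᵥ N *ᵥ x ≤ c * (x ⬝ᵥ x)) : innerF W N ≤ c * W.trace := by
  obtain ⟨U, hU⟩ := exists_isTopEigenvectors (posSemidef_iff.1 hW).1
  rw [← innerF_one_right, innerF_eq_sum_lam hU, innerF_eq_sum_lam hU, Finset.mul_sum]
  refine Finset.sum_le_sum fun j _ => ?_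
  have := mul_le_mul_of_nonneg_left (hN (U.col j)) (hU.lam_nonneg hW j)
  rw [one_mulVec]
  linarith

theorem innerF_le_lam_mul_trace {W N : Matrix (Fin p) (Fin p) ℝ} (hW : W.PosSemidef)
    (hN : N.IsSymm) : innerF W N ≤ lam N 1 * W.trace :=
  innerF_le_of_rayleigh_le hW (rayleigh_le_lam_one hN)

theorem innerF_nonneg {W N : Matrix (Fin p) (Fin p) ℝ} (hW : W.PosSemidef) (hN : N.PosSemidef) :
    0 ≤ innerF W N := by
  have := innerF_le_of_rayleigh_le hW (N := -N) (c := 0) fun x => by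
    simpa [neg_mulVec] using (posSemidef_iff.1 hN).2 x
  rw [innerF_neg_right] at this
  linarith

/-- Positive definite matrices dominate a multiple of the identity. -/
theorem exists_pos_le_rayleigh (hM : M.PosDef) :
    ∃ c : ℝ, 0 < c ∧ ∀ x : Fin p → ℝ, c * (x ⬝ᵥ x) ≤ x ⬝ᵥ M *ᵥ x := by
  rcases Nat.eq_zero_or_pos p with rfl | hp
  · exact ⟨1, one_pos, fun x => by simp [dotProduct]⟩
  have hs := (posDef_iff.1 hM).1
  obtain ⟨U, hU⟩ := exists_isTopEigenvectors hs.neg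
  refine ⟨-lam (-M) 1, ?_, fun x => ?_⟩
  · have h1 := hU.lam_eq ⟨0, hp⟩
    have h2 := (posDef_iff.1 hM).2 (U.col ⟨0, hp⟩) fun h => by
      have := hU.col_dotProduct ⟨0, hp⟩
      simp [h] at this
    rw [neg_mulVec, dotProduct_neg] at h1
    simp only [zero_add] at h1
    linarith
  · have := rayleigh_le_lam_one hs.neg x
    rw [neg_mulVec, dotProduct_neg] at this
    linarith

/-- The Frobenius norm of a positive semidefinite matrix is at most its trace. -/
theorem normF_le_trace (hM : M.PosSemidef) : normF M ≤ M.trace := by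
  have h : normSqF M ≤ M.trace ^ 2 := by
    -- The trace dominates the Rayleigh quotient, as one sees by pairing `M` with `x xᵀ`; pairing
    -- `M` with itself then gives the squared trace.
    have hr : ∀ x : Fin p → ℝ, x ⬝ᵥ M *ᵥ x ≤ M.trace * (x ⬝ᵥ x) := fun x => by
      have hx : (vecMulVec x x).PosSemidef := by simpa using posSemidef_vecMulVec_self_star x
      rw [← innerF_vecMulVec, innerF_comm]
      refine (innerF_le_of_rayleigh_le hM (c := x ⬝ᵥ x) fun y => ?_).trans_eq (mul_comm _ _)
      rw [vecMulVec_mulVec]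
      have h1 := abs_innerF_le (replicateCol (Fin 1) x) (replicateCol (Fin 1) y)
      have h2 : ∀ u v : Fin p → ℝ,
          innerF (replicateCol (Fin 1) u) (replicateCol (Fin 1) v) = u ⬝ᵥ v := fun u v => by
        simp [innerF_eq_sum, Fintype.sum_prod_type, dotProduct]
      have h3 := sq_le_sq' (by linarith [abs_le.1 h1]) (le_of_abs_le h1)
      rw [mul_pow, normF_sq, normF_sq, normSqF, normSqF, h2, h2, h2] at h3
      simp only [op_smul_eq_smul, dotProduct_smul, smul_eq_mul, dotProduct_comm y x]
      linarith
    rw [pow_two]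
    exact innerF_le_of_rayleigh_le hM hr
  rw [normF]
  exact Real.sqrt_le_iff.2 ⟨hM.trace_nonneg, h⟩

end Spectral

/-! ### The positive semidefinite cone and compactness. -/

section Cone
variable {p : ℕ}

theorem normF_transpose (M : Matrix (Fin p) (Fin p) ℝ) : normF Mᵀ = normF M := by
  rw [normF, normSqF, innerF_transpose, normF, normSqF]

theorem lam_neg_one_neg_iff (hp : 0 < p) {M : Matrix (Fin p) (Fin p) ℝ} (hM : M.IsSymm) :
    lam (-M) 1 < 0 ↔ M.PosDef := by
  constructor
  · refine fun h => posDef_iff.2 ⟨hM, fun x hx => ?_⟩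
    have h1 := rayleigh_le_lam_one hM.neg x
    rw [neg_mulVec, dotProduct_neg] at h1
    nlinarith [dotProduct_self_pos hx]
  · intro h
    obtain ⟨U, hU⟩ := exists_isTopEigenvectors hM.neg
    have h1 := hU.lam_eq ⟨0, hp⟩
    have h2 := (posDef_iff.1 h).2 (U.col ⟨0, hp⟩) fun h0 => by
      have := hU.col_dotProduct ⟨0, hp⟩
      simp [h0] at this
    rw [neg_mulVec, dotProduct_neg] at h1
    simp only [zero_add] at h1
    linarith

theorem posSemidef_of_lam_neg_one_le {M : Matrix (Fin p) (Fin p) ℝ} (hM : M.IsSymm)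
    (h : lam (-M) 1 ≤ 0) : M.PosSemidef := by
  refine posSemidef_iff.2 ⟨hM, fun x => ?_⟩
  have h1 := rayleigh_le_lam_one hM.neg x
  rw [neg_mulVec, dotProduct_neg] at h1
  nlinarith [dotProduct_self_nonneg x]

theorem lam_neg_one_le_of_posSemidef (hp : 0 < p) {M : Matrix (Fin p) (Fin p) ℝ}
    (hM : M.PosSemidef) : lam (-M) 1 ≤ 0 := by
  obtain ⟨U, hU⟩ := exists_isTopEigenvectors (posSemidef_iff.1 hM).1.neg
  have h1 := hU.lam_eq ⟨0, hp⟩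
  have h2 := (posSemidef_iff.1 hM).2 (U.col ⟨0, hp⟩)
  rw [neg_mulVec, dotProduct_neg] at h1
  simp only [zero_add] at h1
  linarith

/-- The sum of a symmetric matrix and `max {lam (-X) 1, 0}` times the identity is positive
semidefinite. -/
theorem posSemidef_add_lam_smul_one {X : Matrix (Fin p) (Fin p) ℝ} (hX : X.IsSymm) :
    (X + max (lam (-X) 1) 0 • (1 : Matrix (Fin p) (Fin p) ℝ)).PosSemidef := by
  refine posSemidef_iff.2 ⟨hX.add (isSymm_one.smul _), fun x => ?_⟩
  have h1 := rayleigh_le_lam_one hX.neg x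
  rw [neg_mulVec, dotProduct_neg] at h1
  rw [add_mulVec, dotProduct_add, smul_mulVec, one_mulVec, dotProduct_smul, smul_eq_mul]
  nlinarith [dotProduct_self_nonneg x, le_max_left (lam (-X) 1) 0]

/-- The separation argument runs in the space of all matrices, where the positive definite ones are
not open; passing to the symmetric part restores openness. -/
theorem isOpen_posDef_add_transpose (hp : 0 < p) :
    IsOpen {M : Matrix (Fin p) (Fin p) ℝ | (M + Mᵀ).PosDef} := by
  have hs : ∀ M : Matrix (Fin p) (Fin p) ℝ, (M + Mᵀ).IsSymm := fun M => by
    rw [Matrix.IsSymm, transpose_add, transpose_transpose, add_comm]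
  have hc : Continuous fun M : Matrix (Fin p) (Fin p) ℝ => lam (-(M + Mᵀ)) 1 := by
    rw [← continuousOn_univ]
    refine continuousOn_of_abs_sub_le (L := 2) fun X _ Y _ => ?_
    refine (abs_lam_sub_le (hs X).neg (hs Y).neg hp).trans ?_
    have : -(X + Xᵀ) - -(Y + Yᵀ) = -((X - Y) + (X - Y)ᵀ) := by
      rw [transpose_sub]; abel
    rw [this, normF_neg]
    refine (normF_add_le _ _).trans ?_
    rw [normF_transpose]; linarith
  simp_rw [← lam_neg_one_neg_iff hp (hs _)]
  exact isOpen_lt hc continuous_const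

theorem isCompact_of_normF_le {s : Set (Matrix (Fin p) (Fin p) ℝ)} (hs : IsClosed s) {B : ℝ}
    (hB : ∀ X ∈ s, normF X ≤ B) : IsCompact s := by
  have h : IsCompact {X : Matrix (Fin p) (Fin p) ℝ | ∀ i ∈ Set.univ, X i ∈
      {v : Fin p → ℝ | ∀ j ∈ Set.univ, v j ∈ Set.Icc (-B) B}} :=
    isCompact_univ_pi fun _ => isCompact_univ_pi fun _ => isCompact_Icc
  exact h.of_isClosed_subset hs fun X hX i _ j _ =>
    abs_le.1 ((abs_entry_le X i j).trans (hB X hX))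

end Cone

/-! ### Strong duality by separation of convex sets. -/

namespace SDP
variable {n m : ℕ} (D : SDP n m)

theorem innerF_adj (y : Fin m → ℝ) (X : Matrix (Fin n) (Fin n) ℝ) :
    innerF (D.adj y) X = ∑ i, y i * innerF (D.A i) X := by
  simp [adj, innerF_sum_left, innerF_smul_left]

theorem innerF_adj_of_mem {X : Matrix (Fin n) (Fin n) ℝ} (hX : X ∈ D.affineSet)
    (y : Fin m → ℝ) : innerF (D.adj y) X = D.b ⬝ᵥ y := by
  rw [innerF_adj, dotProduct]
  exact Finset.sum_congr rfl fun i _ => by rw [hX.2 i, mul_comm]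

theorem adj_isSymm (y : Fin m → ℝ) : (D.adj y).IsSymm := by
  rw [Matrix.IsSymm, adj, transpose_sum]
  exact Finset.sum_congr rfl fun i _ => by rw [transpose_smul, (D.A_symm i)]

theorem innerF_symmetrize {S X : Matrix (Fin n) (Fin n) ℝ} (hS : S.IsSymm) :
    innerF S ((1 / 2 : ℝ) • (X + Xᵀ)) = innerF S X := by
  have : innerF S Xᵀ = innerF S X := by
    conv_lhs => rw [← hS.eq, innerF_transpose]
  rw [innerF_smul_right, innerF_add_right, this]; ring

/-- Strong duality: a strictly feasible primal program with a lower bound `v` on its values has a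
dual feasible point of value at least `v`. -/
theorem exists_dual_ge (hn : 0 < n) (hS : ∃ X ∈ D.affineSet, X.PosDef) {v : ℝ}
    (hv : ∀ X ∈ D.affineSet, X.PosSemidef → v ≤ innerF D.C X) :
    ∃ y : Fin m → ℝ, (D.C - D.adj y).PosSemidef ∧ v ≤ D.b ⬝ᵥ y := by
  obtain ⟨X₀, hX₀, hX₀pd⟩ := hS
  -- `S` is the strict epigraph of the cost minus `v` over the open cone, `T` the affine constraint
  -- with nonpositive height. A common point would symmetrize to a feasible matrix of cost below
  -- `v`.
  let S : Set (Matrix (Fin n) (Fin n) ℝ × ℝ) := {q | (q.1 + q.1ᵀ).PosDef ∧ innerF D.C q.1 - v < q.2}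
  let T : Set (Matrix (Fin n) (Fin n) ℝ × ℝ) := {q | (∀ i, innerF (D.A i) q.1 = D.b i) ∧ q.2 ≤ 0}
  have hSc : Convex ℝ S := by
    rw [convex_iff_forall_pos]
    rintro ⟨M, s⟩ ⟨h1, h2⟩ ⟨N, t⟩ ⟨h3, h4⟩ a b ha hb hab
    refine ⟨?_, ?_⟩
    · have := (h1.smul ha).add (h3.smul hb)
      simpa only [Prod.fst_add, Prod.smul_fst, transpose_add, transpose_smul, smul_add,
        add_add_add_comm] using this
    · simp only [Prod.fst_add, Prod.smul_fst, innerF_add_right, innerF_smul_right, Prod.snd_add,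
        Prod.smul_snd, smul_eq_mul]
      simp only at h2 h4
      have h5 : v = a * v + b * v := by rw [← add_mul, hab, one_mul]
      nlinarith
  have hSo : IsOpen S := by
    refine ((isOpen_posDef_add_transpose hn).preimage continuous_fst).inter
      (isOpen_lt ?_ continuous_snd)
    exact (continuous_innerF.comp (continuous_const.prodMk continuous_fst)).sub continuous_const
  have hTc : Convex ℝ T := by
    rintro ⟨M, s⟩ ⟨h1, h2⟩ ⟨N, t⟩ ⟨h3, h4⟩ a b ha hb hab
    refine ⟨fun i => ?_, ?_⟩
    · simp only [Prod.fst_add, Prod.smul_fst, innerF_add_right, innerF_smul_right]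
      simp only at h1 h3
      rw [h1, h3, ← add_mul, hab, one_mul]
    · simp only [Prod.snd_add, Prod.smul_snd, smul_eq_mul]
      simp only at h2 h4
      nlinarith
  have hdisj : Disjoint S T := by
    rw [Set.disjoint_left]
    rintro ⟨M, s⟩ ⟨h1, h2⟩ ⟨h3, h4⟩
    simp only at h1 h2 h3 h4
    have hpd : ((1 / 2 : ℝ) • (M + Mᵀ)).PosDef := h1.smul (by norm_num)
    have := hv _ ⟨(posDef_iff.1 hpd).1, fun i => by
      rw [innerF_symmetrize (D.A_symm i), h3]⟩ hpd.posSemidef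
    rw [innerF_symmetrize D.C_symm] at this
    linarith
  obtain ⟨f, u, hfS, hfT⟩ := geometric_hahn_banach_open hSc hSo hTc hdisj
  set τ := f (0, 1)
  let f1 : Matrix (Fin n) (Fin n) ℝ →ₗ[ℝ] ℝ :=
    f.toLinearMap ∘ₗ LinearMap.inl ℝ (Matrix (Fin n) (Fin n) ℝ) ℝ
  have hf : ∀ M s, f (M, s) = f1 M + s * τ := fun M s => by
    have : ((M, s) : Matrix (Fin n) (Fin n) ℝ × ℝ) = (M, 0) + s • (0, 1) := by simp
    rw [this, map_add, map_smul]; rfl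
  have hXT : ∀ M : Matrix (Fin n) (Fin n) ℝ, (∀ i, innerF (D.A i) M = 0) → ∀ s ≤ 0,
      u ≤ f1 X₀ + f1 M + s * τ :=
    fun M hM s hs => by
      rw [← map_add, ← hf]
      exact hfT _ ⟨fun i => by simp [innerF_add_right, hX₀.2 i, hM i], hs⟩
  let K : Fin m → Matrix (Fin n) (Fin n) ℝ →ₗ[ℝ] ℝ := fun i =>
    { toFun := fun M => innerF (D.A i) M
      map_add' := innerF_add_right _
      map_smul' := fun c M => innerF_smul_right c _ M }
  -- The functional is bounded below on the affine space, hence vanishes on its directions and is a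
  -- combination of the constraints. The multiple of `M` used here would push the value down to `u -
  -- 1`.
  have hker : ⨅ i, LinearMap.ker (K i) ≤ LinearMap.ker f1 := by
    intro M hM
    have hM' : ∀ i, innerF (D.A i) M = 0 := fun i =>
      LinearMap.mem_ker.1 ((Submodule.mem_iInf _).1 hM i)
    by_contra hne
    have hne' : f1 M ≠ 0 := hne
    have := hXT (((u - f1 X₀ - 1) / f1 M) • M) (fun i => by rw [innerF_smul_right, hM' i, mul_zero])
      0 le_rfl
    rw [map_smul, smul_eq_mul, div_mul_cancel₀ _ hne'] at this
    linarith
  obtain ⟨c, hc⟩ := Submodule.mem_span_range_iff_exists_fun ℝ |>.1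
    (mem_span_of_iInf_ker_le_ker hker)
  have hf1 : ∀ M, f1 M = ∑ i, c i * innerF (D.A i) M := fun M => by
    rw [← hc]; simp [K]
  have hcb : f1 X₀ = D.b ⬝ᵥ c := by
    rw [hf1, ← innerF_adj, D.innerF_adj_of_mem hX₀]
  have hsum : ∀ M : Matrix (Fin n) (Fin n) ℝ, M.PosDef → ∀ s,
      innerF D.C M - v < s → f1 M + s * τ < u := fun M hM s hs => by
    rw [← hf]
    refine hfS _ ⟨?_, hs⟩
    have : Mᵀ = M := (posDef_iff.1 hM).1
    simpa only [this] using hM.add hM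
  have hu : u ≤ D.b ⬝ᵥ c := by
    simpa [hcb] using hXT 0 (by simp) 0 le_rfl
  -- The separating hyperplane is not vertical, because the strictly feasible point lies in the
  -- domain of both sets.
  have hτ0 : τ < 0 := by
    by_contra! hτ
    have h1 := hsum X₀ hX₀pd (max (innerF D.C X₀ - v + 1) 0)
      (lt_of_lt_of_le (by linarith) (le_max_left _ _))
    have h2 := mul_nonneg (le_max_right (innerF D.C X₀ - v + 1) 0) hτ
    linarith
  have hZ : ∀ M : Matrix (Fin n) (Fin n) ℝ, M.PosDef →
      v - D.b ⬝ᵥ ((-τ)⁻¹ • c) ≤ innerF (D.C - D.adj ((-τ)⁻¹ • c)) M := fun M hM => by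
    have h1 : f1 M + (innerF D.C M - v) * τ ≤ D.b ⬝ᵥ c := by
      refine le_of_forall_pos_lt_add fun ε hε => ?_
      have := hsum M hM (innerF D.C M - v + ε / (-τ)) (by
        have : 0 < ε / (-τ) := div_pos hε (by linarith)
        linarith)
      have h2 : ε / (-τ) * τ = -ε := by rw [div_neg, neg_mul, div_mul_cancel₀ _ hτ0.ne]
      rw [add_mul, h2] at this
      linarith
    have h3 : innerF (D.adj ((-τ)⁻¹ • c)) M = (-τ)⁻¹ * f1 M := by
      rw [innerF_adj, hf1, Finset.mul_sum]
      exact Finset.sum_congr rfl fun i _ => by simp [mul_assoc]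
    rw [innerF_sub_left, h3, dotProduct_smul, smul_eq_mul]
    have h4 : 0 < (-τ)⁻¹ := inv_pos.2 (by linarith)
    have h5 := mul_le_mul_of_nonneg_left h1 h4.le
    have h6 : (-τ)⁻¹ * ((innerF D.C M - v) * τ) = -(innerF D.C M - v) := by
      have := hτ0.ne
      field_simp
    rw [mul_add, h6] at h5
    linarith
  set y := (-τ)⁻¹ • c
  set Z := D.C - D.adj y with hZdef
  have hZs : Z.IsSymm := D.C_symm.sub (D.adj_isSymm y)
  refine ⟨y, posSemidef_iff.2 ⟨hZs, fun x => ?_⟩, ?_⟩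
  · by_contra! hneg
    set q := x ⬝ᵥ Z *ᵥ x
    -- `x xᵀ` is perturbed to be definite so that `hZ` applies; if `xᵀ Z x` were negative, large
    -- multiples would violate the lower bound.
    have hpd : ∀ ε : ℝ, 0 < ε → (vecMulVec x x + ε • (1 : Matrix (Fin n) (Fin n) ℝ)).PosDef :=
        fun ε hε =>
      Matrix.PosDef.posSemidef_add (by simpa using posSemidef_vecMulVec_self_star x)
        (Matrix.PosDef.one.smul hε)
    obtain ⟨ε, hε, hεt⟩ : ∃ ε : ℝ, 0 < ε ∧ ε * Z.trace < -q := by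
      refine ⟨-q / (2 * (|Z.trace| + 1)), div_pos (by linarith) (by positivity), ?_⟩
      have h1 : Z.trace ≤ |Z.trace| := le_abs_self _
      have h2 : (0 : ℝ) < 2 * (|Z.trace| + 1) := by positivity
      rw [div_mul_eq_mul_div, div_lt_iff₀ h2]
      nlinarith [abs_nonneg Z.trace]
    set w := q + ε * Z.trace with hw
    have hw0 : w < 0 := by linarith
    have hk : ∀ k : ℝ, 0 < k → v - D.b ⬝ᵥ y ≤ k * w := fun k hk => by
      have h1 := hZ _ ((hpd ε hε).smul hk)
      rwa [innerF_smul_right, innerF_add_right, innerF_comm, innerF_vecMulVec, innerF_smul_right,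
        innerF_one_right] at h1
    have h2 := hk ((|v - D.b ⬝ᵥ y| + 1) / (-w)) (div_pos (by positivity) (by linarith))
    have h3 : (|v - D.b ⬝ᵥ y| + 1) / (-w) * w = -(|v - D.b ⬝ᵥ y| + 1) := by
      rw [div_neg, neg_mul, div_mul_cancel₀ _ hw0.ne]
    rw [h3] at h2
    linarith [neg_abs_le (v - D.b ⬝ᵥ y)]
  -- Small multiples of the identity in `hZ` leave only the constant term.
  · refine le_of_forall_pos_le_add fun ε hε => ?_
    have h1 : (0 : ℝ) < |Z.trace| + 1 := by positivity
    have h2 := hZ ((ε / (|Z.trace| + 1)) • (1 : Matrix (Fin n) (Fin n) ℝ))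
      (Matrix.PosDef.one.smul (div_pos hε h1))
    rw [innerF_smul_right, innerF_one_right] at h2
    have h3 : ε / (|Z.trace| + 1) * Z.trace ≤ ε := by
      rw [div_mul_eq_mul_div, div_le_iff₀ h1]
      nlinarith [le_abs_self Z.trace]
    linarith

end SDP
-- Exact penalty, compactness of the optimal set, eigenvalue gaps.
namespace SDP
variable {n m : ℕ} (D : SDP n m)

theorem innerF_C_eq {X : Matrix (Fin n) (Fin n) ℝ} (hX : X ∈ D.affineSet) {y : Fin m → ℝ}
    {Z : Matrix (Fin n) (Fin n) ℝ} (h : Z + D.adj y = D.C) :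
    innerF D.C X = innerF Z X + D.b ⬝ᵥ y := by
  rw [← h, innerF_add_left, D.innerF_adj_of_mem hX]

variable {D}

/-- Strong duality between optimal solutions. -/
theorem zero_gap (hn : 0 < n) (hS : D.Slater) {X : Matrix (Fin n) (Fin n) ℝ}
    (hX : X ∈ D.primalOpt) {q : (Fin m → ℝ) × Matrix (Fin n) (Fin n) ℝ} (hq : q ∈ D.dualOpt) :
    innerF D.C X = D.b ⬝ᵥ q.1 := by
  obtain ⟨y, hy, hle⟩ := D.exists_dual_ge hn hS.1 hX.2
  have h1 := hq.2 y _ (sub_add_cancel _ _) hy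
  have h2 := D.innerF_C_eq hX.1.1 hq.1.1
  have h3 := innerF_nonneg hq.1.2 hX.1.2
  linarith

theorem complementary (hn : 0 < n) (hS : D.Slater) {X : Matrix (Fin n) (Fin n) ℝ}
    (hX : X ∈ D.primalOpt) {q : (Fin m → ℝ) × Matrix (Fin n) (Fin n) ℝ} (hq : q ∈ D.dualOpt) :
    innerF q.2 X = 0 := by
  have h1 := zero_gap hn hS hX hq
  have h2 := D.innerF_C_eq hX.1.1 hq.1.1
  linarith

theorem trace_mul_le_innerF {W N : Matrix (Fin n) (Fin n) ℝ} (hW : W.PosSemidef) {c : ℝ}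
    (hN : ∀ x : Fin n → ℝ, c * (x ⬝ᵥ x) ≤ x ⬝ᵥ N *ᵥ x) : c * W.trace ≤ innerF W N := by
  have := innerF_le_of_rayleigh_le hW (N := -N) (c := -c) fun x => by
    rw [neg_mulVec, dotProduct_neg]; linarith [hN x]
  rw [innerF_neg_right] at this
  linarith

theorem trace_lt_of_mem_dualOpt (hS : D.Slater) {ρ : ℝ} (hρ : D.dualTraceMax < ρ)
    {q : (Fin m → ℝ) × Matrix (Fin n) (Fin n) ℝ} (hq : q ∈ D.dualOpt) : q.2.trace < ρ := by
  -- The real supremum in `dualTraceMax` bounds its elements only if the set is bounded. A strictly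
  -- feasible `X` gives this, since `⟨Z, X⟩` is the same for all dual optimal `Z` and is at least a
  -- multiple of the trace.
  suffices h : BddAbove ((fun p => p.2.trace) '' D.dualOpt) from
    lt_of_le_of_lt (le_csSup h ⟨q, hq, rfl⟩) hρ
  obtain ⟨X, hX, hXpd⟩ := hS.1
  obtain ⟨c, hc, hcX⟩ := exists_pos_le_rayleigh hXpd
  refine ⟨(innerF D.C X - D.b ⬝ᵥ q.1) / c, ?_⟩
  rintro _ ⟨q', hq', rfl⟩
  rw [le_div_iff₀ hc, mul_comm]
  have h1 := trace_mul_le_innerF hq'.1.2 hcX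
  have h2 := D.innerF_C_eq hX hq'.1.1
  have h3 := hq'.2 q.1 q.2 hq.1.1 hq.1.2
  have h4 := hq.2 q'.1 q'.2 hq'.1.1 hq'.1.2
  linarith

theorem rho_pos {ρ : ℝ} (hρ : D.dualTraceMax < ρ) : 0 < ρ := by
  refine lt_of_le_of_lt (Real.sSup_nonneg ?_) hρ
  rintro _ ⟨q, hq, rfl⟩
  exact hq.1.2.trace_nonneg

/-- Exactness of the penalty. -/
theorem le_F {ρ : ℝ} {X : Matrix (Fin n) (Fin n) ℝ} (hX : X ∈ D.affineSet)
    {q : (Fin m → ℝ) × Matrix (Fin n) (Fin n) ℝ} (hq : q ∈ D.dualOpt) :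
    D.b ⬝ᵥ q.1 + (ρ - q.2.trace) * max (lam (-X) 1) 0 ≤ D.F ρ X := by
  -- With `s = max (lam (-X) 1) 0`, pairing `X + s I ⪰ 0` with `Z` gives `⟨Z, X⟩ ≥ -s * tr Z`, which
  -- the penalty `ρ * s` outweighs.
  have h1 := innerF_nonneg hq.1.2 (posSemidef_add_lam_smul_one hX.1)
  rw [innerF_add_right, innerF_smul_right, innerF_one_right] at h1
  rw [F, D.innerF_C_eq hX hq.1.1]
  nlinarith

theorem F_eq_of_posSemidef (hn : 0 < n) {ρ : ℝ} {X : Matrix (Fin n) (Fin n) ℝ}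
    (hX : X.PosSemidef) : D.F ρ X = innerF D.C X := by
  rw [F, max_eq_right (lam_neg_one_le_of_posSemidef hn hX), mul_zero, add_zero]

/-- The surplus `ρ - tr Z > 0` leaves no room for a negative eigenvalue at the optimal cost. -/
theorem mem_primalOpt_iff (hn : 0 < n) (hS : D.Slater) {ρ : ℝ} (hρ : D.dualTraceMax < ρ)
    (hne : D.primalOpt.Nonempty)
    {q : (Fin m → ℝ) × Matrix (Fin n) (Fin n) ℝ} (hq : q ∈ D.dualOpt)
    {X : Matrix (Fin n) (Fin n) ℝ} :
    X ∈ D.primalOpt ↔ X ∈ D.affineSet ∧ D.F ρ X ≤ D.b ⬝ᵥ q.1 := by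
  constructor
  · intro hX
    exact ⟨hX.1.1, by rw [F_eq_of_posSemidef hn hX.1.2, zero_gap hn hS hX hq]⟩
  · rintro ⟨hX, hle⟩
    obtain ⟨Xs, hXs⟩ := hne
    have h1 := le_F (ρ := ρ) hX hq
    have h2 := trace_lt_of_mem_dualOpt hS hρ hq
    have h3 : max (lam (-X) 1) 0 ≤ 0 := by
      by_contra! h
      nlinarith
    have hpsd := posSemidef_of_lam_neg_one_le hX.1 ((le_max_left _ _).trans h3)
    rw [F_eq_of_posSemidef hn hpsd] at hle
    refine ⟨⟨hX, hpsd⟩, fun X' hX' hp => ?_⟩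
    have h4 := zero_gap hn hS hXs hq
    have h5 := hXs.2 X' hX' hp
    linarith

theorem abs_posPart_lam_sub_le {X Y : Matrix (Fin n) (Fin n) ℝ} (hX : X.IsSymm) (hY : Y.IsSymm)
    (hn : 0 < n) : |max (lam (-X) 1) 0 - max (lam (-Y) 1) 0| ≤ normF (X - Y) := by
  have h := abs_lam_sub_le hX.neg hY.neg hn
  rw [show -X - -Y = -(X - Y) by abel, normF_neg] at h
  exact (abs_max_sub_max_le_abs _ _ _).trans h

theorem F_sub_le (hn : 0 < n) {ρ : ℝ} (hρ : 0 ≤ ρ) {X Y : Matrix (Fin n) (Fin n) ℝ}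
    (hX : X.IsSymm) (hY : Y.IsSymm) :
    |D.F ρ X - D.F ρ Y| ≤ (normF D.C + ρ) * normF (X - Y) := by
  have h1 := abs_posPart_lam_sub_le hX hY hn
  have h2 := abs_innerF_le D.C (X - Y)
  rw [innerF_sub_right] at h2
  have h3 : D.F ρ X - D.F ρ Y = (innerF D.C X - innerF D.C Y) +
      ρ * (max (lam (-X) 1) 0 - max (lam (-Y) 1) 0) := by rw [F, F]; ring
  rw [h3, add_mul]
  refine (abs_add_le _ _).trans (add_le_add h2 ?_)
  rw [abs_mul, abs_of_nonneg hρ]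
  exact mul_le_mul_of_nonneg_left h1 hρ

theorem isClosed_affineSet : IsClosed D.affineSet := by
  have h1 : IsClosed {X : Matrix (Fin n) (Fin n) ℝ | Xᵀ = X} :=
    isClosed_eq (by fun_prop) continuous_id
  have h2 : D.affineSet = {X | Xᵀ = X} ∩ ⋂ i, {X | innerF (D.A i) X = D.b i} := by
    ext X; simp [affineSet, Matrix.IsSymm]
  rw [h2]
  exact h1.inter (isClosed_iInter fun i =>
    isClosed_eq (continuous_innerF.comp (continuous_const.prodMk continuous_id)) continuous_const)

theorem continuousOn_F (hn : 0 < n) {ρ : ℝ} (hρ : 0 ≤ ρ) :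
    ContinuousOn (D.F ρ) D.affineSet :=
  continuousOn_of_abs_sub_le fun _ hX _ hY => F_sub_le hn hρ hX.1 hY.1

/-- The surplus `ρ - tr Z` bounds the negative part `s` of `X`; a definite dual feasible `Z` then
bounds the trace of `X + s I`, hence its norm. -/
theorem exists_normF_le (hS : D.Slater) {ρ : ℝ} (hρ : D.dualTraceMax < ρ)
    {q : (Fin m → ℝ) × Matrix (Fin n) (Fin n) ℝ} (hq : q ∈ D.dualOpt) (L : ℝ) :
    ∃ B, 0 ≤ B ∧ ∀ X ∈ D.affineSet, D.F ρ X ≤ L → normF X ≤ B := by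
  obtain ⟨y, Z, hZ, hZpd⟩ := hS.2
  obtain ⟨c, hc, hcZ⟩ := exists_pos_le_rayleigh hZpd
  have hρ0 := rho_pos hρ
  have ht := trace_lt_of_mem_dualOpt hS hρ hq
  set l := max ((L - D.b ⬝ᵥ q.1) / (ρ - q.2.trace)) 0 with hl
  set B := (L - D.b ⬝ᵥ y + l * Z.trace) / c + l * normF (1 : Matrix (Fin n) (Fin n) ℝ) with hB
  refine ⟨max B 0, le_max_right _ _, fun X hX hF => (?_ : normF X ≤ B).trans (le_max_left _ _)⟩
  set s := max (lam (-X) 1) 0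
  have hs0 : 0 ≤ s := le_max_right _ _
  have h1 := le_F (ρ := ρ) hX hq
  have hsl : s ≤ l := by
    refine le_trans ?_ (le_max_left _ _)
    rw [le_div_iff₀ (by linarith)]
    linarith
  have hpsd := posSemidef_add_lam_smul_one hX.1
  have h2 := trace_mul_le_innerF hpsd hcZ
  rw [innerF_comm, innerF_add_right, innerF_smul_right, innerF_one_right] at h2
  have h3 := D.innerF_C_eq hX hZ
  have h4 : innerF D.C X ≤ L := by
    refine le_trans ?_ hF
    rw [F]
    have := mul_nonneg hρ0.le hs0
    linarith
  have h5 := normF_le_trace hpsd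
  have h6 : normF X ≤ normF (X + s • (1 : Matrix (Fin n) (Fin n) ℝ)) +
      s * normF (1 : Matrix (Fin n) (Fin n) ℝ) := by
    have := normF_add_le (X + s • (1 : Matrix (Fin n) (Fin n) ℝ))
      (-(s • (1 : Matrix (Fin n) (Fin n) ℝ)))
    rwa [add_neg_cancel_right, normF_neg, normF_smul, abs_of_nonneg hs0] at this
  have h7 : s * normF (1 : Matrix (Fin n) (Fin n) ℝ) ≤ l * normF (1 : Matrix (Fin n) (Fin n) ℝ) :=
    mul_le_mul_of_nonneg_right hsl (normF_nonneg _)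
  have h8 : (X + s • (1 : Matrix (Fin n) (Fin n) ℝ)).trace ≤
      (L - D.b ⬝ᵥ y + l * Z.trace) / c := by
    rw [le_div_iff₀ hc, mul_comm]
    have := mul_le_mul_of_nonneg_right hsl hZpd.posSemidef.trace_nonneg
    linarith
  linarith

theorem isCompact_sublevel (hn : 0 < n) (hS : D.Slater) {ρ : ℝ} (hρ : D.dualTraceMax < ρ)
    {q : (Fin m → ℝ) × Matrix (Fin n) (Fin n) ℝ} (hq : q ∈ D.dualOpt) (L : ℝ) :
    IsCompact {X | X ∈ D.affineSet ∧ D.F ρ X ≤ L} := by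
  obtain ⟨B, -, hB⟩ := exists_normF_le hS hρ hq L
  refine isCompact_of_normF_le (B := B) ?_ fun X hX => hB X hX.1 hX.2
  exact (continuousOn_F hn (rho_pos hρ).le).preimage_isClosed_of_isClosed isClosed_affineSet
    isClosed_Iic

theorem isCompact_primalOpt (hn : 0 < n) (hS : D.Slater) {ρ : ℝ} (hρ : D.dualTraceMax < ρ)
    (hne : D.primalOpt.Nonempty)
    {q : (Fin m → ℝ) × Matrix (Fin n) (Fin n) ℝ} (hq : q ∈ D.dualOpt) :
    IsCompact D.primalOpt := by
  have : D.primalOpt = {X | X ∈ D.affineSet ∧ D.F ρ X ≤ D.b ⬝ᵥ q.1} :=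
    Set.ext fun X => mem_primalOpt_iff hn hS hρ hne hq
  rw [this]
  exact isCompact_sublevel hn hS hρ hq _

/-- Points of the affine set with almost optimal penalized cost are close to an optimal solution. -/
theorem exists_forall_near_primalOpt (hn : 0 < n) (hS : D.Slater) {ρ : ℝ}
    (hρ : D.dualTraceMax < ρ) (hne : D.primalOpt.Nonempty)
    {q : (Fin m → ℝ) × Matrix (Fin n) (Fin n) ℝ} (hq : q ∈ D.dualOpt) {d : ℝ} (hd : 0 < d) :
    ∃ ε, 0 < ε ∧ ∀ X ∈ D.affineSet, D.F ρ X ≤ D.b ⬝ᵥ q.1 + ε →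
      ∃ Xs ∈ D.primalOpt, normF (X - Xs) < d := by
  set v := D.b ⬝ᵥ q.1
  set U : Set (Matrix (Fin n) (Fin n) ℝ) := {X | ∃ Xs ∈ D.primalOpt, normF (X - Xs) < d} with hU
  have hUo : IsOpen U := by
    have : U = ⋃ Xs ∈ D.primalOpt, {X | normF (X - Xs) < d} := by ext; simp [hU]
    rw [this]
    exact isOpen_biUnion fun Xs _ => isOpen_lt
      (continuous_normF.comp (continuous_id.sub continuous_const)) continuous_const
  -- On this compact set, free of optimal solutions, `F` attains a minimum strictly above `v`; half
  -- of the excess serves as `ε`.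
  set K := {X | X ∈ D.affineSet ∧ D.F ρ X ≤ v + 1} \ U with hK
  have hKc : IsCompact K := (isCompact_sublevel hn hS hρ hq _).diff hUo
  rcases K.eq_empty_or_nonempty with hKe | hKne
  · refine ⟨1, one_pos, fun X hX hF => ?_⟩
    by_contra h
    have : X ∈ K := ⟨⟨hX, hF⟩, h⟩
    rw [hKe] at this
    exact this
  · obtain ⟨X₀, hX₀, hmin⟩ := hKc.exists_isMinOn hKne
      ((continuousOn_F (D := D) hn (rho_pos hρ).le).mono fun X hX => hX.1.1)
    have hv : v < D.F ρ X₀ := by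
      by_contra! h
      refine hX₀.2 ⟨X₀, (mem_primalOpt_iff hn hS hρ hne hq).2 ⟨hX₀.1.1, h⟩, ?_⟩
      simpa using hd
    refine ⟨min 1 ((D.F ρ X₀ - v) / 2), lt_min one_pos (by linarith), fun X hX hF => ?_⟩
    by_contra h
    have h1 : X ∈ K := ⟨⟨hX, hF.trans (by linarith [min_le_left 1 ((D.F ρ X₀ - v) / 2)])⟩, h⟩
    have h2 : D.F ρ X₀ ≤ D.F ρ X := hmin h1
    linarith [min_le_right 1 ((D.F ρ X₀ - v) / 2)]

theorem finrank_ker_le_sigmaP {X : Matrix (Fin n) (Fin n) ℝ} (hX : X ∈ D.primalOpt) :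
    Module.finrank ℝ (LinearMap.ker X.mulVecLin) ≤ D.sigmaP := by
  refine le_csSup ⟨n, ?_⟩ ⟨X, hX, rfl⟩
  rintro _ ⟨Y, -, rfl⟩
  simpa using Submodule.finrank_le (LinearMap.ker Y.mulVecLin)

/-- The eigenvalue of index `σ_p + 1` of `-X` is negative for an optimal `X`. -/
theorem lam_sigmaP_neg (hσ : D.sigmaP < n) {X : Matrix (Fin n) (Fin n) ℝ}
    (hX : X ∈ D.primalOpt) : lam (-X) (D.sigmaP + 1) < 0 := by
  by_contra! h
  have hs := hX.1.1.1
  obtain ⟨U, hU⟩ := exists_isTopEigenvectors hs.neg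
  have hV := hU.castLE (k' := D.sigmaP + 1) hσ
  set V := U.submatrix id (Fin.castLE (n := D.sigmaP + 1) hσ)
  have hle := lam_neg_one_le_of_posSemidef (by omega) hX.1.2
  -- Under the contrary assumption the top `σ_p + 1` eigenvalues of `-X` all vanish, making the
  -- kernel of `X` too large.
  have hker : LinearMap.range V.mulVecLin ≤ LinearMap.ker X.mulVecLin := by
    rintro _ ⟨a, rfl⟩
    rw [LinearMap.mem_ker, mulVecLin_apply, mulVecLin_apply]
    have h1 := hV.mulVec_mulVec a
    have h2 : (fun j : Fin (D.sigmaP + 1) => lam (-X) ((j : ℕ) + 1) * a j) = 0 := by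
      ext j
      have h3 := lam_antitone hs.neg (Nat.lt_succ_iff.1 j.2) hσ
      have h4 := lam_antitone hs.neg (Nat.zero_le (j : ℕ)) (by omega)
      rw [zero_add] at h4
      have h5 : lam (-X) ((j : ℕ) + 1) = 0 := by linarith
      simp [h5]
    rw [h2, mulVec_zero, neg_mulVec, neg_eq_zero] at h1
    exact h1
  have h1 := Submodule.finrank_mono hker
  have h2 : Function.Injective V.mulVecLin := by
    rw [← LinearMap.ker_eq_bot, LinearMap.ker_eq_bot']
    intro a ha
    have := hV.dotProduct_mulVec a a
    rw [mulVecLin_apply] at ha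
    rw [ha, zero_dotProduct] at this
    exact dotProduct_self_eq_zero.1 this.symm
  rw [LinearMap.finrank_range_of_inj h2, Module.finrank_fin_fun] at h1
  have := finrank_ker_le_sigmaP hX
  omega

theorem exists_gap_pos (hσ : D.sigmaP < n) (hS : D.Slater) {ρ : ℝ} (hρ : D.dualTraceMax < ρ)
    (hne : D.primalOpt.Nonempty)
    {q : (Fin m → ℝ) × Matrix (Fin n) (Fin n) ℝ} (hq : q ∈ D.dualOpt) :
    ∃ g, 0 < g ∧ ∀ X ∈ D.primalOpt, lam (-X) (D.sigmaP + 1) ≤ -g := by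
  have hn : 0 < n := by omega
  have hc : ContinuousOn (fun X => lam (-X) (D.sigmaP + 1)) D.primalOpt := by
    refine continuousOn_of_abs_sub_le (L := 1) fun X hX Y hY => ?_
    have h := abs_lam_sub_le hX.1.1.1.neg hY.1.1.1.neg hσ
    rwa [show -X - -Y = -(X - Y) by abel, normF_neg, ← one_mul (normF (X - Y))] at h
  obtain ⟨X₀, hX₀, hmax⟩ := (isCompact_primalOpt hn hS hρ hne hq).exists_isMaxOn hne hc
  refine ⟨-lam (-X₀) (D.sigmaP + 1), neg_pos.2 (lam_sigmaP_neg hσ hX₀), fun X hX => ?_⟩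
  rw [neg_neg]
  exact hmax hX

theorem finite_gap_image (X : Matrix (Fin n) (Fin n) ℝ) :
    ((fun r : ℕ => lam (-X) r - lam (-X) (r + 1)) '' Set.Icc 1 D.sigmaP).Finite :=
  (Set.finite_Icc _ _).image _

theorem sSup_gap_nonneg (hσ : D.sigmaP < n) {X : Matrix (Fin n) (Fin n) ℝ} (hX : X.IsSymm) :
    0 ≤ sSup ((fun r : ℕ => lam (-X) r - lam (-X) (r + 1)) '' Set.Icc 1 D.sigmaP) := by
  refine Real.sSup_nonneg ?_
  rintro _ ⟨r, ⟨hr1, hr2⟩, rfl⟩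
  obtain ⟨k, rfl⟩ : ∃ k, r = k + 1 := ⟨r - 1, by omega⟩
  exact sub_nonneg.2 (lam_antitone hX.neg (Nat.le_succ k) (by omega))

theorem gap_le (hσ : D.sigmaP < n) {X : Matrix (Fin n) (Fin n) ℝ} (hX : X ∈ D.primalOpt) :
    D.gap ≤ sSup ((fun r : ℕ => lam (-X) r - lam (-X) (r + 1)) '' Set.Icc 1 D.sigmaP) := by
  refine csInf_le ⟨0, ?_⟩ ⟨X, hX, rfl⟩
  rintro _ ⟨Y, hY, rfl⟩
  exact sSup_gap_nonneg hσ hY.1.1.1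

/-- A positive gap separates the eigenvalue of index `σ_p + 1` of `-X` from the positive part of the
largest one. -/
theorem lam_sigmaP_le_of_gap_pos (hσ : D.sigmaP < n) (hgap : 0 < D.gap)
    {X : Matrix (Fin n) (Fin n) ℝ} (hX : X ∈ D.primalOpt) :
    lam (-X) (D.sigmaP + 1) ≤ max (lam (-X) 1) 0 - D.gap := by
  have h := gap_le hσ hX
  -- For `σ_p = 0` the supremum is over the empty set and equals `0`, contrary to a positive gap.
  have hne : ((fun r : ℕ => lam (-X) r - lam (-X) (r + 1)) '' Set.Icc 1 D.sigmaP).Nonempty := by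
    by_contra hemp
    rw [Set.not_nonempty_iff_eq_empty.1 hemp, Real.sSup_empty] at h
    linarith
  obtain ⟨r, ⟨hr1, hr2⟩, hr⟩ := hne.csSup_mem (finite_gap_image X)
  obtain ⟨k, rfl⟩ : ∃ k, r = k + 1 := ⟨r - 1, by omega⟩
  rw [← hr] at h
  have hs := hX.1.1.1.neg
  have h1 := lam_antitone hs (Nat.zero_le k) (by omega)
  have h2 := lam_antitone hs hr2 hσ
  have h3 := le_max_left (lam (-X) 1) 0
  simp only [zero_add] at h1
  linarith

/-- If `C` is outside the span, the dual optimal `Z` is nonzero, so by complementarity no optimal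
`X` is definite and `lam (-X) 1 = 0`. The drop from there to index `σ_p + 1` is at least a uniform
`g` and is shared by `σ_p` consecutive differences, so one of them is at least `g / σ_p`. -/
theorem gap_pos (hsc : D.StrictComplementarity) (hS : D.Slater) {ρ : ℝ}
    (hρ : D.dualTraceMax < ρ)
    (hC : D.C ∉ Submodule.span ℝ (Set.range D.A)) (hσ : D.sigmaP < n) : 0 < D.gap := by
  obtain ⟨X₀, hX₀, q, hq, -⟩ := hsc
  have hn : 0 < n := by omega
  have hne : D.primalOpt.Nonempty := ⟨X₀, hX₀⟩
  obtain ⟨g, hg, hgX⟩ := exists_gap_pos hσ hS hρ hne hq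
  have hZ : q.2 ≠ 0 := by
    intro h0
    apply hC
    rw [← hq.1.1, h0, zero_add, adj]
    exact Submodule.sum_mem _ fun i _ => Submodule.smul_mem _ _ (Submodule.subset_span ⟨i, rfl⟩)
  have hlam : ∀ X ∈ D.primalOpt, lam (-X) 1 = 0 := by
    intro X hX
    refine (lam_neg_one_le_of_posSemidef hn hX.1.2).antisymm ?_
    by_contra! hlt
    have hpd := (lam_neg_one_neg_iff hn hX.1.1.1).1 hlt
    obtain ⟨c, hc, hcX⟩ := exists_pos_le_rayleigh hpd
    have h1 := trace_mul_le_innerF hq.1.2 hcX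
    rw [complementary hn hS hX hq] at h1
    have h2 : q.2.trace ≤ 0 := by
      by_contra! h
      nlinarith
    have h3 := (normF_le_trace hq.1.2).trans h2
    refine hZ (normSqF_eq_zero ?_)
    rw [← normF_sq, le_antisymm h3 (normF_nonneg _)]
    norm_num
  have hσ1 : 0 < D.sigmaP := by
    by_contra! h
    have h0 : D.sigmaP = 0 := by omega
    have h1 := hgX X₀ hX₀
    rw [h0, zero_add, hlam X₀ hX₀] at h1
    linarith
  have hσ1' : (0 : ℝ) < D.sigmaP := by exact_mod_cast hσ1
  refine lt_of_lt_of_le (div_pos hg hσ1') (le_csInf (hne.image _) ?_)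
  rintro _ ⟨X, hX, rfl⟩
  rw [div_le_iff₀ hσ1']
  set s := sSup ((fun r : ℕ => lam (-X) r - lam (-X) (r + 1)) '' Set.Icc 1 D.sigmaP)
  have hk : ∀ k ≤ D.sigmaP, lam (-X) 1 - lam (-X) (k + 1) ≤ s * k := by
    intro k
    induction k with
    | zero => intro _; simp
    | succ k ih =>
      intro hk
      have h1 := ih (by omega)
      have h2 : lam (-X) (k + 1) - lam (-X) (k + 1 + 1) ≤ s :=
        le_csSup (finite_gap_image X).bddAbove ⟨k + 1, ⟨by omega, hk⟩, rfl⟩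
      push_cast
      linarith
  have h1 := hk _ le_rfl
  rw [hlam X hX] at h1
  have h2 := hgX X hX
  linarith

end SDP
-- The spectral model: minorant property and quadratic closeness.
namespace SDP
variable {n m r : ℕ} {D : SDP n m} {Wbar : Matrix (Fin n) (Fin n) ℝ}
  {P : Matrix (Fin n) (Fin r) ℝ}

theorem zero_mem_weightSet {τ : ℝ} (hτ : 0 ≤ τ) : 0 ∈ weightSet τ Wbar P :=
  ⟨0, 0, PosSemidef.zero, le_rfl, by simpa using hτ, by simp⟩

theorem smul_mem_weightSet {τ c : ℝ} (hc : 0 ≤ c) {W : Matrix (Fin n) (Fin n) ℝ}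
    (hW : W ∈ weightSet τ Wbar P) : c • W ∈ weightSet (c * τ) Wbar P := by
  obtain ⟨γ, S, hS, hγ, hle, rfl⟩ := hW
  refine ⟨c * γ, c • S, hS.smul hc, mul_nonneg hc hγ, ?_, ?_⟩
  · rw [trace_smul, smul_eq_mul, ← mul_add]
    exact mul_le_mul_of_nonneg_left hle hc
  · rw [smul_add, smul_smul, Matrix.mul_smul, Matrix.smul_mul]

theorem convex_weightSet {τ : ℝ} : Convex ℝ (weightSet τ Wbar P) := by
  rintro _ ⟨γ, S, hS, hγ, hle, rfl⟩ _ ⟨γ', S', hS', hγ', hle', rfl⟩ a b ha hb hab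
  refine ⟨a * γ + b * γ', a • S + b • S', (hS.smul ha).add (hS'.smul hb), by positivity, ?_, ?_⟩
  · rw [trace_add, trace_smul, trace_smul, smul_eq_mul, smul_eq_mul]
    have h1 := mul_le_mul_of_nonneg_left hle ha
    have h2 := mul_le_mul_of_nonneg_left hle' hb
    have h3 : a * τ + b * τ = τ := by rw [← add_mul, hab, one_mul]
    linarith
  · simp only [Matrix.mul_add, Matrix.add_mul, Matrix.mul_smul, Matrix.smul_mul, smul_add, add_smul,
      mul_smul]
    abel

theorem trace_conj (hP : Pᵀ * P = 1) (S : Matrix (Fin r) (Fin r) ℝ) :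
    (P * S * Pᵀ).trace = S.trace := by
  rw [Matrix.trace_mul_comm, ← Matrix.mul_assoc, hP, Matrix.one_mul]

theorem posSemidef_conj {S : Matrix (Fin r) (Fin r) ℝ} (hS : S.PosSemidef)
    (B : Matrix (Fin n) (Fin r) ℝ) : (B * S * Bᵀ).PosSemidef := by
  simpa using hS.mul_mul_conjTranspose_same B

theorem posSemidef_of_mem_weightSet (hW : Wbar.PosSemidef) {τ : ℝ}
    {W : Matrix (Fin n) (Fin n) ℝ} (h : W ∈ weightSet τ Wbar P) : W.PosSemidef := by
  obtain ⟨γ, S, hS, hγ, -, rfl⟩ := h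
  exact (hW.smul hγ).add (posSemidef_conj hS P)

theorem trace_le_of_mem_weightSet (hW : Wbar.trace = 1) (hP : Pᵀ * P = 1) {τ : ℝ}
    {W : Matrix (Fin n) (Fin n) ℝ} (h : W ∈ weightSet τ Wbar P) : W.trace ≤ τ := by
  obtain ⟨γ, S, hS, hγ, hle, rfl⟩ := h
  rwa [trace_add, trace_smul, hW, trace_conj hP, smul_eq_mul, mul_one]

theorem innerF_neg_le_of_mem_weightSet (hW : Wbar.PosSemidef) (hW1 : Wbar.trace = 1)
    (hP : Pᵀ * P = 1) {τ : ℝ} {W : Matrix (Fin n) (Fin n) ℝ} (h : W ∈ weightSet τ Wbar P)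
    {X : Matrix (Fin n) (Fin n) ℝ} (hX : X.IsSymm) :
    innerF W (-X) ≤ τ * max (lam (-X) 1) 0 := by
  have hpsd := posSemidef_of_mem_weightSet hW h
  have h1 := innerF_le_lam_mul_trace hpsd hX.neg
  have h2 := trace_le_of_mem_weightSet hW1 hP h
  have h3 := hpsd.trace_nonneg
  have h4 := mul_le_mul_of_nonneg_right (le_max_left (lam (-X) 1) 0) h3
  have h5 := mul_le_mul_of_nonneg_right h2 (le_max_right (lam (-X) 1) 0)
  linarith

/-- Moves the factor `ρ` into the weight set; with `le_model` it describes the model as a maximum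
over weights of size `ρ`. -/
theorem model_le {ρ : ℝ} (hρ : 0 < ρ) {X : Matrix (Fin n) (Fin n) ℝ} {c : ℝ}
    (h : ∀ W ∈ weightSet ρ Wbar P, innerF W (-X) ≤ c) :
    D.model ρ Wbar P X ≤ innerF D.C X + c := by
  rw [model]
  gcongr
  rw [← le_div_iff₀' hρ]
  refine csSup_le (Set.Nonempty.image _ ⟨0, zero_mem_weightSet zero_le_one⟩) ?_
  rintro _ ⟨W, hW, rfl⟩
  rw [le_div_iff₀' hρ, ← innerF_smul_left]
  exact h _ (by simpa using smul_mem_weightSet hρ.le hW)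

theorem model_le_F (hW : Wbar.PosSemidef) (hW1 : Wbar.trace = 1) (hP : Pᵀ * P = 1) {ρ : ℝ}
    (hρ : 0 < ρ) {X : Matrix (Fin n) (Fin n) ℝ} (hX : X.IsSymm) :
    D.model ρ Wbar P X ≤ D.F ρ X :=
  model_le hρ fun _ h => innerF_neg_le_of_mem_weightSet hW hW1 hP h hX

theorem le_model (hW : Wbar.PosSemidef) (hW1 : Wbar.trace = 1) (hP : Pᵀ * P = 1) {ρ : ℝ}
    (hρ : 0 < ρ) {X : Matrix (Fin n) (Fin n) ℝ} (hX : X.IsSymm)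
    {W : Matrix (Fin n) (Fin n) ℝ} (h : W ∈ weightSet ρ Wbar P) :
    innerF (D.C - W) X ≤ D.model ρ Wbar P X := by
  rw [innerF_sub_left, model, sub_eq_add_neg, ← innerF_neg_right]
  gcongr
  rw [← div_le_iff₀' hρ]
  refine le_csSup ⟨1 * max (lam (-X) 1) 0, ?_⟩ ⟨ρ⁻¹ • W, ?_, ?_⟩
  · rintro _ ⟨W', hW', rfl⟩
    exact innerF_neg_le_of_mem_weightSet hW hW1 hP hW' hX
  · have := smul_mem_weightSet (inv_nonneg.2 hρ.le) h
    rwa [inv_mul_cancel₀ hρ.ne'] at this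
  · simp only [innerF_smul_left]
    rw [div_eq_inv_mul]

theorem dotProduct_mulVec_orth (hP : Pᵀ * P = 1) (a b : Fin r → ℝ) :
    (P *ᵥ a) ⬝ᵥ (P *ᵥ b) = a ⬝ᵥ b := by
  rw [dotProduct_comm, Matrix.dotProduct_mulVec, ← mulVec_transpose, Matrix.mulVec_mulVec, hP,
    one_mulVec, dotProduct_comm]

theorem vecMulVec_mem_weightSet (hP : Pᵀ * P = 1) {τ c : ℝ} (hc : 0 ≤ c) {x : Fin n → ℝ}
    (hx : x ∈ LinearMap.range P.mulVecLin) (hτ : c * (x ⬝ᵥ x) ≤ τ) :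
    c • vecMulVec x x ∈ weightSet τ Wbar P := by
  obtain ⟨b, rfl⟩ := hx
  rw [mulVecLin_apply, dotProduct_mulVec_orth hP] at hτ
  refine ⟨0, c • vecMulVec b b, Matrix.PosSemidef.smul ?_ hc, le_rfl, ?_, ?_⟩
  · simpa using posSemidef_vecMulVec_self_star b
  · rwa [trace_smul, trace_vecMulVec, zero_add, smul_eq_mul]
  · rw [zero_smul, zero_add, Matrix.mul_smul, Matrix.smul_mul, mulVecLin_apply,
      mul_vecMulVec, vecMulVec_mul, vecMul_transpose]

/-- The scalar estimate behind the quadratic upper bound. -/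
theorem scalar_quadratic_bound {m e g A B : ℝ} (he : 0 ≤ e) (hg : 0 < g) (hA : 0 ≤ A) (hB : 0 ≤ B)
    (h : A ^ 2 + B ^ 2 = 1) :
    m * A ^ 2 + 2 * (e * (B * A)) + (m + 2 * e - g) * B ^ 2 ≤ m + 4 / g * e ^ 2 := by
  have hA1 : A ≤ 1 := by nlinarith
  have hB1 : B ≤ 1 := by nlinarith
  have h1 : e * (B * A) ≤ e * B := by
    have := mul_le_mul_of_nonneg_left hA1 (mul_nonneg he hB)
    linarith
  have h2 : e * B ^ 2 ≤ e * B := by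
    have := mul_le_mul_of_nonneg_left hB1 (mul_nonneg he hB)
    linarith
  -- Completing the square; the two `e * B` pairs come from the cross term and from the error in the
  -- lower block.
  have h3 : 4 * (e * B) - g * B ^ 2 ≤ 4 / g * e ^ 2 := by
    have h4 : 4 / g * e ^ 2 - (4 * (e * B) - g * B ^ 2) = (2 * e - g * B) ^ 2 / g := by
      field_simp; ring
    have : 0 ≤ (2 * e - g * B) ^ 2 / g := by positivity
    linarith
  have h5 : m * A ^ 2 + m * B ^ 2 = m := by rw [← mul_add, h, mul_one]
  linarith

/-- Quadratic upper bound on the penalized cost in terms of a model that contains enough top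
eigenvectors at `Om`. -/
theorem F_le_model_add (hW : Wbar.PosSemidef) (hW1 : Wbar.trace = 1) (hP : Pᵀ * P = 1) {ρ : ℝ}
    (hρ : 0 < ρ) {k : ℕ} (hk : 0 < k) (hkn : k < n) {Om X : Matrix (Fin n) (Fin n) ℝ}
    (hOm : Om.IsSymm) (hX : X.IsSymm) {V : Matrix (Fin n) (Fin k) ℝ}
    (hV : IsTopEigenvectors (-Om) V)
    (hVP : LinearMap.range V.mulVecLin ≤ LinearMap.range P.mulVecLin) {g : ℝ} (hg : 0 < g)
    (hgap : lam (-Om) (k + 1) ≤ max (lam (-Om) 1) 0 - g) :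
    D.F ρ X ≤ D.model ρ Wbar P X + ρ * (4 / g) * normSqF (X - Om) := by
  have hn : 0 < n := by omega
  -- `μ` is the model's estimate of `max (lam (-X) 1) 0`; it bounds the Rayleigh quotients of `-X`
  -- on the range of `V`.
  set μ := (D.model ρ Wbar P X - innerF D.C X) / ρ with hμ
  have hWμ : ∀ W ∈ weightSet ρ Wbar P, -innerF W X ≤ ρ * μ := fun W h => by
    have := le_model (D := D) hW hW1 hP hρ hX h
    rw [innerF_sub_left] at this
    rw [hμ, mul_div_cancel₀ _ hρ.ne']
    linarith
  have hμ0 : 0 ≤ μ := by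
    have := hWμ 0 (zero_mem_weightSet hρ.le)
    rw [innerF_zero_left, neg_zero] at this
    exact nonneg_of_mul_nonneg_right this hρ
  have hVμ : ∀ a : Fin k → ℝ, (V *ᵥ a) ⬝ᵥ (-X) *ᵥ (V *ᵥ a) ≤ μ * (a ⬝ᵥ a) := fun a => by
    by_cases ha : a = 0
    · simp [ha]
    have hpos := dotProduct_self_pos ha
    have h1 := hWμ _ (vecMulVec_mem_weightSet hP (c := ρ / (a ⬝ᵥ a)) (by positivity)
      (hVP ⟨a, rfl⟩) (by
        rw [mulVecLin_apply, hV.dotProduct_mulVec, div_mul_cancel₀ _ hpos.ne']))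
    rw [innerF_smul_left, innerF_vecMulVec, mulVecLin_apply] at h1
    rw [neg_mulVec, dotProduct_neg]
    have h2 : ρ * (-(V *ᵥ a ⬝ᵥ X *ᵥ V *ᵥ a)) ≤ ρ * (μ * (a ⬝ᵥ a)) := by
      rw [← neg_mul, neg_mul, div_mul_eq_mul_div, ← neg_div, div_le_iff₀ hpos] at h1
      linarith
    exact le_of_mul_le_mul_left h2 hρ
  set e := normF (X - Om) with he
  have he0 : 0 ≤ e := normF_nonneg _
  have hE : normF (-X - -Om) = e := by
    rw [show -X - -Om = -(X - Om) by abel, normF_neg]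
  have hlam1 : max (lam (-Om) 1) 0 ≤ μ + e := by
    refine max_le ?_ (by linarith)
    have h1 := hV.lam_eq ⟨0, hk⟩
    have h2 := abs_le.1 (abs_rayleigh_le (V.col ⟨0, hk⟩) (-X - -Om))
    have h3 := hVμ (Pi.single ⟨0, hk⟩ 1)
    rw [mulVec_single_one, dotProduct_single, Pi.single_eq_same, mul_one, mul_one] at h3
    rw [sub_mulVec, dotProduct_sub, hV.col_dotProduct, hE, mul_one] at h2
    simp only [zero_add] at h1
    linarith [h2.1]
  suffices hmain : lam (-X) 1 ≤ μ + 4 / g * e ^ 2 by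
    have h1 : max (lam (-X) 1) 0 ≤ μ + 4 / g * e ^ 2 := max_le hmain (by positivity)
    have h2 := mul_le_mul_of_nonneg_left h1 hρ.le
    have h3 : ρ * μ = D.model ρ Wbar P X - innerF D.C X := by
      rw [hμ, mul_div_cancel₀ _ hρ.ne']
    rw [F, ← normF_sq]
    linarith
  obtain ⟨U, hU⟩ := exists_isTopEigenvectors hX.neg
  set u := U.col ⟨0, hn⟩
  have hu : u ⬝ᵥ (-X) *ᵥ u = lam (-X) 1 := hU.lam_eq ⟨0, hn⟩
  have hu1 : u ⬝ᵥ u = 1 := hU.col_dotProduct ⟨0, hn⟩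
  set a := Vᵀ *ᵥ u with ha
  set w := u - V *ᵥ a with hw
  have hVw : Vᵀ *ᵥ w = 0 := by
    rw [hw, mulVec_sub, ← ha, Matrix.mulVec_mulVec, hV.1, one_mulVec, sub_self]
  have horth : ∀ b, w ⬝ᵥ (V *ᵥ b) = 0 := fun b => by
    rw [Matrix.dotProduct_mulVec, ← mulVec_transpose, hVw, zero_dotProduct]
  have hdec : u = V *ᵥ a + w := by rw [hw]; abel
  have hsq : a ⬝ᵥ a + w ⬝ᵥ w = 1 := by
    rw [← hu1]
    conv_rhs => rw [hdec]
    simp only [add_dotProduct, dotProduct_add, horth, dotProduct_comm (V *ᵥ a) w,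
      hV.dotProduct_mulVec]
    ring
  -- The range of `V` is invariant under `-Om` and orthogonal to `w`, so only the difference `-X -
  -- -Om` contributes.
  have hcross : w ⬝ᵥ (-X) *ᵥ (V *ᵥ a) ≤ e * (Real.sqrt (w ⬝ᵥ w) * Real.sqrt (a ⬝ᵥ a)) := by
    have h1 := le_of_abs_le (abs_dotProduct_mulVec_le w (V *ᵥ a) (-X - -Om))
    rwa [sub_mulVec, dotProduct_sub, hV.mulVec_mulVec, horth, sub_zero, hE,
      hV.dotProduct_mulVec] at h1
  -- One `e` comes from comparing `lam (-Om) 1` with `μ`, the other from replacing `-Om` by `-X`.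
  have hww : w ⬝ᵥ (-X) *ᵥ w ≤ (μ + 2 * e - g) * (w ⬝ᵥ w) := by
    have h1 := le_of_abs_le (abs_rayleigh_le w (-X - -Om))
    rw [sub_mulVec, dotProduct_sub, hE] at h1
    have h2 := hV.rayleigh_le_of_orthogonal hOm.neg hkn hVw
    have h3 : lam (-Om) (k + 1) ≤ μ + e - g := by linarith
    have h4 := mul_le_mul_of_nonneg_right h3 (dotProduct_self_nonneg w)
    linarith
  have hexp : u ⬝ᵥ (-X) *ᵥ u = (V *ᵥ a) ⬝ᵥ (-X) *ᵥ (V *ᵥ a) + 2 * (w ⬝ᵥ (-X) *ᵥ (V *ᵥ a)) +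
      w ⬝ᵥ (-X) *ᵥ w := by
    rw [hdec]
    simp only [mulVec_add, add_dotProduct, dotProduct_add,
      dotProduct_mulVec_comm hX.neg (V *ᵥ a) w]
    ring
  have hA := Real.sq_sqrt (dotProduct_self_nonneg a)
  have hB := Real.sq_sqrt (dotProduct_self_nonneg w)
  have hfin := scalar_quadratic_bound (m := μ) he0 hg (Real.sqrt_nonneg (a ⬝ᵥ a))
    (Real.sqrt_nonneg (w ⬝ᵥ w)) (by rw [hA, hB, hsq])
  rw [hA, hB] at hfin
  have h1 := hVμ a
  linarith

end SDP
-- Aggregation and the optimality conditions of the master problem.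
namespace SDP

/-- First-order optimality along a segment: for small `s` the linear term dominates. -/
theorem nonneg_of_forall_nonneg_quadratic {a c : ℝ}
    (h : ∀ s : ℝ, 0 < s → s ≤ 1 → 0 ≤ s * a + s ^ 2 * c) : 0 ≤ a := by
  by_contra! ha
  have hc : 0 < c := by
    have := h 1 one_pos le_rfl
    linarith
  have hs : 0 < min 1 (-a / (2 * c)) := lt_min one_pos (div_pos (by linarith) (by linarith))
  have h1 := h _ hs (min_le_left _ _)
  have h2 : min 1 (-a / (2 * c)) * c ≤ -a / 2 := by
    have := mul_le_mul_of_nonneg_right (min_le_right 1 (-a / (2 * c))) hc.le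
    have h3 : -a / (2 * c) * c = -a / 2 := by field_simp
    linarith
  nlinarith

section Blocks
variable {n k : ℕ}

theorem mul_transpose_mul_of_range_le {r : ℕ} {P : Matrix (Fin n) (Fin r) ℝ} (hP : Pᵀ * P = 1)
    {B : Matrix (Fin n) (Fin k) ℝ}
    (h : LinearMap.range B.mulVecLin ≤ LinearMap.range P.mulVecLin) : P * (Pᵀ * B) = B := by
  refine Matrix.ext_of_mulVec_single fun i => ?_
  obtain ⟨b, hb⟩ := h ⟨Pi.single i 1, rfl⟩
  rw [mulVecLin_apply, mulVecLin_apply] at hb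
  rw [← Matrix.mulVec_mulVec, ← Matrix.mulVec_mulVec, ← hb, Matrix.mulVec_mulVec b Pᵀ P, hP,
    one_mulVec]

theorem eq_mul_diagonal_mul {S Q : Matrix (Fin k) (Fin k) ℝ} (hQ : IsTopEigenvectors S Q) :
    S = Q * diagonal (fun j : Fin k => lam S ((j : ℕ) + 1)) * Qᵀ := by
  rw [← hQ.2, Matrix.mul_assoc, hQ.mul_transpose, Matrix.mul_one]

theorem mul_diagonal_mul_transpose_split {a b : ℕ} (Q : Matrix (Fin k) (Fin (a + b)) ℝ)
    (d : Fin (a + b) → ℝ) :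
    Q * diagonal d * Qᵀ =
      Q.submatrix id (Fin.castAdd b) * diagonal (fun j => d (Fin.castAdd b j)) *
        (Q.submatrix id (Fin.castAdd b))ᵀ +
      Q.submatrix id (Fin.natAdd a) * diagonal (fun j => d (Fin.natAdd a j)) *
        (Q.submatrix id (Fin.natAdd a))ᵀ := by
  ext i j
  rw [Matrix.add_apply, Matrix.mul_apply, Matrix.mul_apply, Matrix.mul_apply, Fin.sum_univ_add]
  simp [mul_diagonal]

theorem transpose_mul_submatrix {r : ℕ} {Q : Matrix (Fin k) (Fin r) ℝ} (hQ : Qᵀ * Q = 1) {l : ℕ}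
    {f : Fin l → Fin r} (hf : Function.Injective f) :
    (Q.submatrix id f)ᵀ * Q.submatrix id f = 1 := by
  ext i j
  have := congrFun (congrFun hQ (f i)) (f j)
  simpa [Matrix.mul_apply, Matrix.one_apply, hf.eq_iff] using this

end Blocks

namespace Run
variable {n m : ℕ} {D : SDP n m} {ρ α β : ℝ} {rp rc : ℕ} {Om0 : Matrix (Fin n) (Fin n) ℝ}
  (R : D.Run ρ α β rp rc Om0)

/-- The weight that is kept in full, spanned by the first `rp` eigenvectors of `S_t`. -/
noncomputable def kept (t : ℕ) : Matrix (Fin n) (Fin n) ℝ :=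
  R.P t * (R.Q t).submatrix id (Fin.castAdd rc) *
    diagonal (fun j : Fin rp => lam (R.S t) ((j : ℕ) + 1)) *
    (R.P t * (R.Q t).submatrix id (Fin.castAdd rc))ᵀ

/-- The weight that is aggregated, spanned by the last `rc` eigenvectors of `S_t`. -/
noncomputable def dropped (t : ℕ) : Matrix (Fin n) (Fin n) ℝ :=
  R.P t * ((R.Q t).submatrix id (Fin.natAdd rp) *
    diagonal (fun j : Fin rc => lam (R.S t) (rp + (j : ℕ) + 1)) *
    ((R.Q t).submatrix id (Fin.natAdd rp))ᵀ) * (R.P t)ᵀ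

theorem P_orthonormal (t : ℕ) : (R.P t)ᵀ * R.P t = 1 := by
  cases t with
  | zero => exact R.P_zero.1
  | succ t => exact R.P_orth t

theorem lam_S_nonneg (t : ℕ) (j : Fin (rp + rc)) : 0 ≤ lam (R.S t) ((j : ℕ) + 1) :=
  (R.Q_eig t).lam_nonneg (R.S_psd t) j

theorem lam_S_nonneg_natAdd (t : ℕ) (j : Fin rc) : 0 ≤ lam (R.S t) (rp + (j : ℕ) + 1) :=
  R.lam_S_nonneg t (Fin.natAdd rp j)

theorem conj_S_eq (t : ℕ) : R.P t * R.S t * (R.P t)ᵀ = R.kept t + R.dropped t := by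
  conv_lhs => rw [eq_mul_diagonal_mul (R.Q_eig t), mul_diagonal_mul_transpose_split]
  rw [kept, dropped, Matrix.mul_add, Matrix.add_mul, transpose_mul]
  simp only [Matrix.mul_assoc, Fin.val_castAdd, Fin.val_natAdd]

theorem trace_dropped (t : ℕ) :
    (R.dropped t).trace = ∑ j : Fin rc, lam (R.S t) (rp + (j : ℕ) + 1) := by
  rw [dropped, trace_conj (R.P_orthonormal t),
    trace_conj (transpose_mul_submatrix (R.Q_eig t).1 (Fin.natAdd_injective _ _)), trace_diagonal]

theorem posSemidef_dropped (t : ℕ) : (R.dropped t).PosSemidef :=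
  posSemidef_conj (posSemidef_conj (PosSemidef.diagonal fun j => R.lam_S_nonneg_natAdd t j) _) _

theorem sum_nonneg (t : ℕ) : 0 ≤ ∑ j : Fin rc, lam (R.S t) (rp + (j : ℕ) + 1) :=
  Finset.sum_nonneg fun j _ => R.lam_S_nonneg_natAdd t j

/-- The weight matrices are positive semidefinite of unit trace. -/
theorem Wbar_spec (t : ℕ) : (R.Wbar t).PosSemidef ∧ (R.Wbar t).trace = 1 := by
  induction t with
  | zero => exact R.Wbar_zero
  | succ t ih =>
    by_cases h : R.γ t + (∑ j : Fin rc, lam (R.S t) (rp + (j : ℕ) + 1)) = 0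
    · exact R.Wbar_succ_zero t h
    · have h1 := add_nonneg (R.γ_nonneg t) (R.sum_nonneg t)
      rw [R.Wbar_succ t h]
      change Matrix.PosSemidef (_ • (_ + R.dropped t)) ∧ Matrix.trace (_ • (_ + R.dropped t)) = 1
      refine ⟨((ih.1.smul (R.γ_nonneg t)).add (R.posSemidef_dropped t)).smul (inv_nonneg.2 h1), ?_⟩
      rw [trace_smul, trace_add, trace_smul, ih.2, R.trace_dropped, smul_eq_mul, smul_eq_mul,
        mul_one, inv_mul_cancel₀ h]

/-- Clearing the denominator covers the degenerate case too: if it is `0`, then `γ t` and the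
dropped weight both vanish, so the arbitrary choice of `Wbar (t + 1)` has no effect. -/
theorem aggregate_eq (t : ℕ) :
    (R.γ t + ∑ j : Fin rc, lam (R.S t) (rp + (j : ℕ) + 1)) • R.Wbar (t + 1) =
      R.γ t • R.Wbar t + R.dropped t := by
  by_cases h : R.γ t + (∑ j : Fin rc, lam (R.S t) (rp + (j : ℕ) + 1)) = 0
  · have h1 := R.γ_nonneg t
    have h2 := R.sum_nonneg t
    have h3 : R.γ t = 0 := by linarith
    have h4 : (R.dropped t).trace = 0 := by rw [R.trace_dropped]; linarith
    have h5 : R.dropped t = 0 := (R.posSemidef_dropped t).trace_eq_zero_iff.1 h4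
    rw [h, h3, h5]; simp
  · rw [R.Wbar_succ t h, smul_smul, mul_inv_cancel₀ h, one_smul]
    rfl

/-- The master solution `W_t`. -/
noncomputable def W (t : ℕ) : Matrix (Fin n) (Fin n) ℝ :=
  R.γ t • R.Wbar t + R.P t * R.S t * (R.P t)ᵀ

theorem W_mem (t : ℕ) : R.W t ∈ weightSet ρ (R.Wbar t) (R.P t) :=
  ⟨R.γ t, R.S t, R.S_psd t, R.γ_nonneg t, R.coeff_le t, rfl⟩

/-- The master solution stays available in the next model. -/
theorem W_mem_succ (t : ℕ) : R.W t ∈ weightSet ρ (R.Wbar (t + 1)) (R.P (t + 1)) := by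
  set B := R.P t * (R.Q t).submatrix id (Fin.castAdd rc) with hB
  set d : Fin rp → ℝ := fun j => lam (R.S t) ((j : ℕ) + 1) with hd
  have hPB : R.P (t + 1) * ((R.P (t + 1))ᵀ * B) = B :=
    mul_transpose_mul_of_range_le (R.P_orth t) (R.P_span_past t)
  have hkept : R.kept t = B * diagonal d * Bᵀ := rfl
  have hd0 : 0 ≤ d := fun j => R.lam_S_nonneg t (Fin.castAdd rc j)
  have heq : R.P (t + 1) * ((R.P (t + 1))ᵀ * B * diagonal d * ((R.P (t + 1))ᵀ * B)ᵀ) *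
      (R.P (t + 1))ᵀ = R.kept t := by
    have h1 : R.P (t + 1) * ((R.P (t + 1))ᵀ * B * diagonal d * ((R.P (t + 1))ᵀ * B)ᵀ) *
      (R.P (t + 1))ᵀ = (R.P (t + 1) * ((R.P (t + 1))ᵀ * B)) * diagonal d *
        (R.P (t + 1) * ((R.P (t + 1))ᵀ * B))ᵀ := by
      rw [transpose_mul (R.P (t + 1))]
      simp only [Matrix.mul_assoc]
    rw [h1, hPB, hkept]
  -- The normalizing factor is the coefficient of the new `Wbar`; the kept part is rewritten in the
  -- basis `P (t + 1)`, whose range contains it.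
  refine ⟨R.γ t + ∑ j : Fin rc, lam (R.S t) (rp + (j : ℕ) + 1),
    (R.P (t + 1))ᵀ * B * diagonal d * ((R.P (t + 1))ᵀ * B)ᵀ,
    posSemidef_conj (PosSemidef.diagonal hd0) _,
    add_nonneg (R.γ_nonneg t) (R.sum_nonneg t), ?_, ?_⟩
  · rw [← trace_conj (R.P_orth t), heq, ← R.trace_dropped]
    have h1 := congrArg trace (R.conj_S_eq t)
    rw [trace_conj (R.P_orthonormal t), trace_add] at h1
    linarith [R.coeff_le t]
  · rw [heq, R.aggregate_eq, W, R.conj_S_eq]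
    abel

/-- A weight in the next model that is active at the candidate. -/
theorem exists_active_weight (hrc : 0 < rc) (hρ : 0 < ρ) (t : ℕ) :
    ∃ W ∈ weightSet ρ (R.Wbar (t + 1)) (R.P (t + 1)),
      innerF (D.C - W) (R.cand (t + 1)) = D.F ρ (R.cand (t + 1)) ∧ normF W ≤ ρ := by
  by_cases h : 0 ≤ lam (-R.cand (t + 1)) 1
  · set v := (R.V t).col ⟨0, hrc⟩ with hv
    have hv1 : v ⬝ᵥ v = 1 := (R.V_eig t).col_dotProduct _
    have hmem : v ∈ LinearMap.range (R.P (t + 1)).mulVecLin :=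
      R.P_span_current t ⟨Pi.single ⟨0, hrc⟩ 1, by rw [mulVecLin_apply, mulVec_single_one]⟩
    refine ⟨ρ • vecMulVec v v, vecMulVec_mem_weightSet (R.P_orth t) hρ.le hmem (by simp [hv1]),
      ?_, ?_⟩
    · have h1 := (R.V_eig t).lam_eq ⟨0, hrc⟩
      rw [neg_mulVec, dotProduct_neg] at h1
      simp only [zero_add] at h1
      rw [innerF_sub_left, innerF_smul_left, innerF_vecMulVec, F, max_eq_left h, ← h1]
      ring
    · rw [normF_smul, abs_of_pos hρ, normF, normSqF_vecMulVec, hv1]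
      simp
  · refine ⟨0, zero_mem_weightSet hρ.le, ?_, by simpa using hρ.le⟩
    rw [sub_zero, F, max_eq_right (le_of_not_ge h), mul_zero, add_zero]

theorem Om_isSymm (hOm0 : Om0.IsSymm) (t : ℕ) : (R.Om t).IsSymm := by
  induction t with
  | zero => rw [R.Om_zero]; exact hOm0
  | succ t ih =>
    by_cases h : t ≠ 0 ∨ R.Om 0 ∈ D.affineSet
    · by_cases h2 : β * (D.F ρ (R.Om t) - D.model ρ (R.Wbar t) (R.P t) (R.cand (t + 1))) ≤
        D.F ρ (R.Om t) - D.F ρ (R.cand (t + 1))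
      · rw [R.step_descent t h h2]; exact (R.cand_mem t).1
      · rw [R.step_null t h h2]; exact ih
    · push Not at h
      obtain ⟨rfl, h0⟩ := h
      rw [zero_add, R.step_affine h0]
      exact (R.cand_mem 0).1

/-- Optimality conditions of the master problem: the aggregate is a linear minorant of the model,
exact at the candidate, and its proximal regularization is minimized there. -/
theorem master_spec (hOm0 : Om0.IsSymm) (hρ : 0 < ρ) (hα : 0 < α) (t : ℕ) :
    D.model ρ (R.Wbar t) (R.P t) (R.cand (t + 1)) = innerF (D.C - R.W t) (R.cand (t + 1)) ∧
    ∀ X ∈ D.affineSet, innerF (D.C - R.W t) X + α / 2 * normSqF (X - R.Om t) =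
      innerF (D.C - R.W t) (R.cand (t + 1)) + α / 2 * normSqF (R.cand (t + 1) - R.Om t) +
        α / 2 * normSqF (X - R.cand (t + 1)) := by
  obtain ⟨hW, hW1⟩ := R.Wbar_spec t
  have hP := R.P_orthonormal t
  set G := R.W t - D.C + D.adj (R.y t) with hG
  -- The primal point recovered from the dual solution. Stationarity in `y` makes it feasible,
  -- optimality in `W` makes `R.W t` active at it, and `hcand` identifies it with the candidate.
  set X' := R.Om t + α⁻¹ • G with hX'
  have hopt : ∀ W ∈ weightSet ρ (R.Wbar t) (R.P t), ∀ y',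
      D.dualMasterObj α (R.Om t) (R.W t) (R.y t) ≤ D.dualMasterObj α (R.Om t) W y' := R.dual_opt t
  have hsW : (R.W t).IsSymm := (posSemidef_iff.1 (posSemidef_of_mem_weightSet hW (R.W_mem t))).1
  have hX's : X'.IsSymm := (R.Om_isSymm hOm0 t).add
    (((hsW.sub D.C_symm).add (D.adj_isSymm _)).smul _)
  have hline : ∀ (s : ℝ) (H : Matrix (Fin n) (Fin n) ℝ) (z : Fin m → ℝ),
      D.dualMasterObj α (R.Om t) (R.W t + s • H) (R.y t + s • z) -
        D.dualMasterObj α (R.Om t) (R.W t) (R.y t) =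
      s * (innerF H (R.Om t) - (fun i => D.b i - innerF (D.A i) (R.Om t)) ⬝ᵥ z +
        α⁻¹ * innerF G (H + D.adj z)) + s ^ 2 * (1 / (2 * α) * normSqF (H + D.adj z)) := by
    intro s H z
    have h1 : R.W t + s • H - D.C + D.adj (R.y t + s • z) = G + s • (H + D.adj z) := by
      have : D.adj (R.y t + s • z) = D.adj (R.y t) + s • D.adj z := by
        simp only [adj, Pi.add_apply, Pi.smul_apply, smul_eq_mul, add_smul, Finset.sum_add_distrib,
          Finset.smul_sum, mul_smul]
      rw [this, hG, smul_add]; abel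
    rw [dualMasterObj, dualMasterObj, h1, ← hG, normSqF_add, normSqF_smul, innerF_smul_right,
      dotProduct_add, dotProduct_smul, innerF_sub_left, innerF_add_left, innerF_smul_left,
      innerF_sub_left, smul_eq_mul]
    field_simp
    ring
  have hX'mem : X' ∈ D.affineSet := by
    refine ⟨hX's, fun i => ?_⟩
    have hz : ∀ z : Fin m → ℝ, 0 ≤ -((fun i => D.b i - innerF (D.A i) (R.Om t)) ⬝ᵥ z) +
        α⁻¹ * innerF G (D.adj z) := fun z => by
      refine nonneg_of_forall_nonneg_quadratic
        (c := 1 / (2 * α) * normSqF (D.adj z)) fun s _ _ => ?_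
      have h1 := hline s 0 z
      have h2 := hopt (R.W t) (R.W_mem t) (R.y t + s • z)
      simp only [smul_zero, add_zero, zero_add, innerF_zero_left, zero_sub] at h1
      linarith
    have hadj : ∀ c : ℝ, D.adj (Pi.single i c) = c • D.A i := fun c => by
      rw [adj, Finset.sum_eq_single i (fun j _ hj => by rw [Pi.single_eq_of_ne hj, zero_smul])
        (by simp), Pi.single_eq_same]
    have h1 := hz (Pi.single i 1)
    have h2 := hz (Pi.single i (-1))
    rw [hadj, dotProduct_single, innerF_smul_right] at h1 h2
    rw [hX', innerF_add_right, innerF_smul_right, innerF_comm (D.A i) G]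
    linarith
  have hWmax : ∀ W ∈ weightSet ρ (R.Wbar t) (R.P t), innerF W (-X') ≤ -innerF (R.W t) X' := by
    intro W hWm
    have h0 : 0 ≤ innerF (W - R.W t) (R.Om t) + α⁻¹ * innerF G (W - R.W t) := by
      refine nonneg_of_forall_nonneg_quadratic
        (c := 1 / (2 * α) * normSqF (W - R.W t)) fun s hs hs1 => ?_
      have h1 := hline s (W - R.W t) 0
      have h2 := hopt (R.W t + s • (W - R.W t))
        (convex_weightSet.add_smul_sub_mem (R.W_mem t) hWm ⟨hs.le, hs1⟩) (R.y t)
      have h3 : D.adj 0 = 0 := by simp [adj]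
      rw [smul_zero, add_zero, h3, add_zero, dotProduct_zero, sub_zero] at h1
      linarith
    have h4 : innerF (W - R.W t) X' = innerF (W - R.W t) (R.Om t) + α⁻¹ * innerF G (W - R.W t) := by
      rw [hX', innerF_add_right, innerF_smul_right, innerF_comm G]
    rw [← h4, innerF_sub_left] at h0
    rw [innerF_neg_right]
    linarith
  have hmodel : D.model ρ (R.Wbar t) (R.P t) X' = innerF (D.C - R.W t) X' := by
    refine le_antisymm ?_ (le_model hW hW1 hP hρ hX's (R.W_mem t))
    refine (model_le hρ hWmax).trans_eq ?_
    rw [innerF_sub_left]; ring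
  have hquad : ∀ X ∈ D.affineSet, innerF (D.C - R.W t) X + α / 2 * normSqF (X - R.Om t) =
      innerF (D.C - R.W t) X' + α / 2 * normSqF (X' - R.Om t) + α / 2 * normSqF (X - X') := by
    intro X hX
    -- On the affine set the `adj` term is constant, so the regularized aggregate is a pure
    -- quadratic centred at `X'`.
    have h1 : D.C - R.W t = D.adj (R.y t) - α • (X' - R.Om t) := by
      rw [hX', add_sub_cancel_left, smul_smul, mul_inv_cancel₀ hα.ne', one_smul, hG]; abel
    have h2 : X - R.Om t = (X' - R.Om t) + (X - X') := by abel
    have h3 : innerF (D.C - R.W t) (X - X') = -(α * innerF (X' - R.Om t) (X - X')) := by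
      rw [h1, innerF_sub_left, innerF_smul_left, innerF_sub_right,
        D.innerF_adj_of_mem hX, D.innerF_adj_of_mem hX'mem]
      ring
    rw [innerF_sub_right] at h3
    rw [h2, normSqF_add]
    linarith
  -- The regularized aggregate lies below the master objective and agrees with it at `X'`; its
  -- strong convexity leaves no other minimizer.
  have hcand : R.cand (t + 1) = X' := by
    have h1 : D.masterObj ρ α (R.Wbar t) (R.P t) (R.Om t) (R.cand (t + 1)) ≤
        D.masterObj ρ α (R.Wbar t) (R.P t) (R.Om t) X' := R.cand_opt t hX'mem
    rw [masterObj, masterObj, hmodel] at h1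
    have h2 := hquad _ (R.cand_mem t)
    have h3 := le_model (D := D) hW hW1 hP hρ (R.cand_mem t).1 (R.W_mem t)
    have h4 := normSqF_nonneg (R.cand (t + 1) - X')
    have h5 : α / 2 * normSqF (R.cand (t + 1) - X') ≤ 0 := by linarith
    have h6 : normSqF (R.cand (t + 1) - X') = 0 := by nlinarith
    exact sub_eq_zero.1 (normSqF_eq_zero h6)
  rw [hcand]
  exact ⟨hmodel, hquad⟩

end Run
end SDP
-- Convergence of the method, uniform over runs.
namespace SDP

theorem le_of_quadratic_le {a d M K : ℝ} (ha : 0 < a) (hM : 0 ≤ M) (hK : 0 ≤ K)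
    (h : a * d ^ 2 ≤ M * d + K) : d ≤ 1 + (M + K) / a := by
  by_cases hd : d ≤ 1
  · have : 0 ≤ (M + K) / a := by positivity
    linarith
  · push Not at hd
    have h1 : d ≤ (M + K) / a := by
      rw [le_div_iff₀ ha]
      have h2 : K ≤ K * d := by nlinarith
      have h3 : d * (a * d) ≤ d * (M + K) := by nlinarith
      have := le_of_mul_le_mul_left h3 (by linarith)
      linarith
    linarith

/-- Iteration count of a method in which every step before accuracy `ε` either decreases the
objective `f` by `c` or increases its lower estimate `w` by `κ`. -/
theorem exists_forall_le_of_potential {L v ε c κ U : ℝ} (hc : 0 < c) (hκ : 0 < κ) (hU : 0 ≤ U) :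
    ∃ T : ℕ, 0 < T ∧ ∀ f w : ℕ → ℝ, f 1 ≤ L → (∀ t, 0 < t → v ≤ f t) →
      (∀ t, 0 < t → f (t + 1) ≤ f t) → (∀ t, 0 < t → w t ≤ f t ∧ f t ≤ w t + U) →
      (∀ t, 0 < t → v + ε < f t →
        f (t + 1) ≤ f t - c ∨ (f (t + 1) = f t ∧ w t + κ ≤ w (t + 1))) →
      ∀ t, T ≤ t → f t ≤ v + ε := by
  -- The potential `A * f - w` falls by at least `κ` each step. A null step raises `w` by `κ`. In a
  -- descent step `(A - 1) * f` falls by `U + κ`, while `f - w`, lying between `0` and `U`, rises by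
  -- at most `U`. The resulting count involves only the constants.
  set A := 1 + (U + κ) / c with hA
  obtain ⟨N, hN⟩ := exists_nat_gt ((A * L - v + U - (A - 1) * v) / κ)
  rw [div_lt_iff₀ hκ] at hN
  refine ⟨N + 1, Nat.succ_pos N, fun f w hL hv hmono hw hstep => ?_⟩
  have hA1 : 0 ≤ A - 1 := by rw [hA, add_sub_cancel_left]; positivity
  have hAc : (A - 1) * c = U + κ := by
    rw [hA, add_sub_cancel_left, div_mul_cancel₀ _ hc.ne']
  have hT : f (N + 1) ≤ v + ε := by
    by_contra! hlt
    have hanti : ∀ i j, 0 < i → i ≤ j → f j ≤ f i := fun i j hi hij => by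
      induction j, hij using Nat.le_induction with
      | base => exact le_rfl
      | succ j hij ih => exact (hmono j (by omega)).trans ih
    have hpot : ∀ j ≤ N, A * f (j + 1) - w (j + 1) ≤ A * f 1 - w 1 - j * κ := by
      intro j
      induction j with
      | zero => intro _; simp
      | succ j ih =>
        intro hj
        have h1 := ih (by omega)
        have h2 : v + ε < f (j + 1) := hlt.trans_le (hanti _ _ (by omega) (by omega))
        have h3 := hw (j + 1) (by omega)
        have h4 := hw (j + 1 + 1) (by omega)
        push_cast
        rcases hstep (j + 1) (by omega) h2 with h5 | ⟨h5, h6⟩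
        · have h7 := mul_le_mul_of_nonneg_left h5 hA1
          nlinarith
        · rw [h5]; linarith
    have h1 := hpot N le_rfl
    have h2 := hw (N + 1) (by omega)
    have h3 := hw 1 one_pos
    have h4 := hv (N + 1) (by omega)
    have h5 := hv 1 one_pos
    have h6 := mul_le_mul_of_nonneg_left h4 hA1
    have h7 := mul_le_mul_of_nonneg_left hL (show 0 ≤ A by linarith)
    nlinarith
  intro t ht
  induction t, ht using Nat.le_induction with
  | base => exact hT
  | succ t ht ih => exact (hmono t (by omega)).trans ih

variable {n m : ℕ} {D : SDP n m}

theorem affineSet_lineMap_mem {X Y : Matrix (Fin n) (Fin n) ℝ} (hX : X ∈ D.affineSet)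
    (hY : Y ∈ D.affineSet) (s : ℝ) : X + s • (Y - X) ∈ D.affineSet :=
  ⟨hX.1.add ((hY.1.sub hX.1).smul s), fun i => by
    rw [innerF_add_right, innerF_smul_right, innerF_sub_right, hX.2, hY.2, sub_self, mul_zero,
      add_zero]⟩

namespace Run
variable {ρ α β : ℝ} {rp rc : ℕ} {Om0 : Matrix (Fin n) (Fin n) ℝ}
  (R : D.Run ρ α β rp rc Om0)

/-- Optimal value of the master problem at iteration `t`. -/
noncomputable def proxVal (t : ℕ) : ℝ :=
  innerF (D.C - R.W t) (R.cand (t + 1)) + α / 2 * normSqF (R.cand (t + 1) - R.Om t)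

/-- The condition for a descent step. -/
def IsDescent (t : ℕ) : Prop :=
  β * (D.F ρ (R.Om t) - D.model ρ (R.Wbar t) (R.P t) (R.cand (t + 1))) ≤
    D.F ρ (R.Om t) - D.F ρ (R.cand (t + 1))

theorem Om_mem {t : ℕ} (ht : t ≠ 0 ∨ R.Om 0 ∈ D.affineSet) : R.Om t ∈ D.affineSet := by
  induction t with
  | zero => simpa using ht
  | succ t ih =>
    by_cases h : t ≠ 0 ∨ R.Om 0 ∈ D.affineSet
    · by_cases h2 : R.IsDescent t
      · rw [R.step_descent t h h2]; exact R.cand_mem t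
      · rw [R.step_null t h h2]; exact ih h
    · push Not at h
      obtain ⟨rfl, h0⟩ := h
      rw [zero_add, R.step_affine h0]
      exact R.cand_mem 0

theorem model_le_F (hρ : 0 < ρ) (t : ℕ) {X : Matrix (Fin n) (Fin n) ℝ} (hX : X.IsSymm) :
    D.model ρ (R.Wbar t) (R.P t) X ≤ D.F ρ X :=
  SDP.model_le_F (R.Wbar_spec t).1 (R.Wbar_spec t).2 (R.P_orthonormal t) hρ hX

theorem aggregate_le_model (hρ : 0 < ρ) (t : ℕ) {X : Matrix (Fin n) (Fin n) ℝ} (hX : X.IsSymm) :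
    innerF (D.C - R.W t) X ≤ D.model ρ (R.Wbar t) (R.P t) X :=
  le_model (R.Wbar_spec t).1 (R.Wbar_spec t).2 (R.P_orthonormal t) hρ hX (R.W_mem t)

theorem normF_W_le (t : ℕ) : normF (R.W t) ≤ ρ :=
  (normF_le_trace (posSemidef_of_mem_weightSet (R.Wbar_spec t).1 (R.W_mem t))).trans
    (trace_le_of_mem_weightSet (R.Wbar_spec t).2 (R.P_orthonormal t) (R.W_mem t))

section
variable (hOm0 : Om0.IsSymm) (hρ : 0 < ρ) (hα : 0 < α)
include hOm0 hρ hα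

theorem proxVal_eq (t : ℕ) : R.proxVal t = D.model ρ (R.Wbar t) (R.P t) (R.cand (t + 1)) +
    α / 2 * normSqF (R.cand (t + 1) - R.Om t) := by
  rw [proxVal, (R.master_spec hOm0 hρ hα t).1]

/-- Proximal decrease predicted by the model. -/
theorem step_gain {t : ℕ} (ht : t ≠ 0 ∨ R.Om 0 ∈ D.affineSet) :
    α * normSqF (R.cand (t + 1) - R.Om t) ≤
      D.F ρ (R.Om t) - D.model ρ (R.Wbar t) (R.P t) (R.cand (t + 1)) := by
  obtain ⟨h1, h2⟩ := R.master_spec hOm0 hρ hα t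
  have hOm := R.Om_mem ht
  have h3 := h2 _ hOm
  have h4 := (R.aggregate_le_model hρ t hOm.1).trans (R.model_le_F hρ t hOm.1)
  have h5 : normSqF (R.Om t - R.cand (t + 1)) = normSqF (R.cand (t + 1) - R.Om t) := by
    rw [← normSqF_neg, neg_sub]
  have h6 : normSqF (R.Om t - R.Om t) = 0 := by simp [normSqF]
  rw [h5, h6] at h3
  rw [h1]
  linarith

theorem F_succ_le (hβ : 0 < β) {t : ℕ} (ht : t ≠ 0 ∨ R.Om 0 ∈ D.affineSet) :
    D.F ρ (R.Om (t + 1)) ≤ D.F ρ (R.Om t) := by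
  by_cases h : R.IsDescent t
  · rw [R.step_descent t ht h]
    have h1 := R.step_gain hOm0 hρ hα ht
    have h2 := mul_nonneg hα.le (normSqF_nonneg (R.cand (t + 1) - R.Om t))
    have h3 := mul_nonneg hβ.le (h2.trans h1)
    have h4 : _ ≤ _ := h
    linarith
  · rw [R.step_null t ht h]

/-- The first candidate lies in a ball that does not depend on the run. -/
theorem normF_cand_one_sub_le {X : Matrix (Fin n) (Fin n) ℝ} (hX : X ∈ D.affineSet) :
    normF (R.cand 1 - X) ≤ 1 + (normF D.C + ρ + α / 2 * normSqF (X - Om0)) / (α / 2) := by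
  refine le_of_quadratic_le (by linarith) (add_nonneg (normF_nonneg _) hρ.le)
    (mul_nonneg (by linarith) (normSqF_nonneg _)) ?_
  have h1 := (R.master_spec hOm0 hρ hα 0).2 X hX
  rw [R.Om_zero] at h1
  have h2 := innerF_le (D.C - R.W 0) (X - R.cand 1)
  rw [innerF_sub_right] at h2
  have h3 : normF (D.C - R.W 0) ≤ normF D.C + ρ := by
    have h4 := normF_add_le D.C (-R.W 0)
    rw [normF_neg, ← sub_eq_add_neg] at h4
    linarith [R.normF_W_le 0]
  have h5 := mul_le_mul_of_nonneg_right h3 (normF_nonneg (X - R.cand 1))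
  have h6 := normSqF_nonneg (R.cand 1 - Om0)
  rw [normF_sub_comm (R.cand 1) X, normF_sq]
  nlinarith

/-- The predicted decrease is bounded below away from the optimum. -/
theorem proxVal_le {t : ℕ} (ht : t ≠ 0 ∨ R.Om 0 ∈ D.affineSet)
    {Xs : Matrix (Fin n) (Fin n) ℝ} (hXs : Xs ∈ D.affineSet) {s : ℝ} (hs : 0 ≤ s) (hs1 : s ≤ 1) :
    R.proxVal t ≤ D.F ρ (R.Om t) - s * (D.F ρ (R.Om t) - D.F ρ Xs) +
      α / 2 * (s ^ 2 * normSqF (Xs - R.Om t)) := by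
  have hOm := R.Om_mem ht
  -- The master value is compared with the point at fraction `s` of the segment from `Om t` to `Xs`.
  have h1 := (R.master_spec hOm0 hρ hα t).2 _ (affineSet_lineMap_mem hOm hXs s)
  rw [add_sub_cancel_left, normSqF_smul, innerF_add_right, innerF_smul_right,
    innerF_sub_right] at h1
  have h2 := (R.aggregate_le_model hρ t hOm.1).trans (R.model_le_F hρ t hOm.1)
  have h3 := (R.aggregate_le_model hρ t hXs.1).trans (R.model_le_F hρ t hXs.1)
  have h4 := normSqF_nonneg (R.Om t + s • (Xs - R.Om t) - R.cand (t + 1))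
  rw [proxVal]
  have h5 := mul_le_mul_of_nonneg_left h2 (sub_nonneg.2 hs1)
  have h6 := mul_le_mul_of_nonneg_left h3 hs
  nlinarith

/-- A null step increases the value of the master problem. -/
theorem proxVal_succ_ge (hrc : 0 < rc) {t : ℕ} (hOm : R.Om (t + 1) = R.Om t) {τ d : ℝ}
    (hτ : 0 < τ) (hd : normF (R.cand (t + 1) - R.Om t) ≤ d)
    (hgap : τ ≤ D.F ρ (R.cand (t + 1)) - D.model ρ (R.Wbar t) (R.P t) (R.cand (t + 1))) :
    R.proxVal t + min (τ / 2) (α / 2 * (τ / (2 * (normF D.C + ρ + α * d))) ^ 2) ≤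
      R.proxVal (t + 1) := by
  obtain ⟨W', hW', hWF, hWn⟩ := R.exists_active_weight hrc hρ t
  set Z := R.cand (t + 1 + 1) with hZdef
  set X := R.cand (t + 1) with hXdef
  have hZ : Z ∈ D.affineSet := R.cand_mem (t + 1)
  have hX : X ∈ D.affineSet := R.cand_mem t
  have hd0 : 0 ≤ d := (normF_nonneg _).trans hd
  have hnext := R.proxVal_eq hOm0 hρ hα (t + 1)
  rw [hOm, ← hZdef] at hnext
  obtain ⟨hW, hW1⟩ := R.Wbar_spec (t + 1)
  have hP := R.P_orthonormal (t + 1)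
  have h1 := le_model (D := D) hW hW1 hP hρ hZ.1 (R.W_mem_succ t)
  have h2 := le_model (D := D) hW hW1 hP hρ hZ.1 hW'
  obtain ⟨hmod, hquad⟩ := R.master_spec hOm0 hρ hα t
  have h3 := hquad Z hZ
  have hM : 0 < normF D.C + ρ + α * d := by
    have := normF_nonneg D.C
    positivity
  set M := normF D.C + ρ + α * d with hMdef
  -- `M` bounds the slope of the new cut plus that of the proximal term. If consecutive candidates
  -- are close, the cut keeps at least half of its lift `τ` at `Z`; if they are far apart, strong
  -- convexity of the old aggregate gives the increase.
  by_cases hcase : M * normF (Z - X) ≤ τ / 2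
  · refine (add_le_add_right (min_le_left _ _) _).trans ?_
    have h4 : -(normF (D.C - W') * normF (Z - X)) ≤ innerF (D.C - W') (Z - X) :=
      (abs_le.1 (abs_innerF_le _ _)).1
    have h5 : normF (D.C - W') ≤ normF D.C + ρ := by
      have h6 := normF_add_le D.C (-W')
      rw [normF_neg, ← sub_eq_add_neg] at h6
      linarith
    have h7 := mul_le_mul_of_nonneg_right h5 (normF_nonneg (Z - X))
    have h8 : Z - R.Om t = (X - R.Om t) + (Z - X) := by abel
    have h9 : -(normF (X - R.Om t) * normF (Z - X)) ≤ innerF (X - R.Om t) (Z - X) :=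
      (abs_le.1 (abs_innerF_le _ _)).1
    have h10 := mul_le_mul_of_nonneg_right hd (normF_nonneg (Z - X))
    have h11 := normSqF_nonneg (Z - X)
    have h12 : -(d * normF (Z - X)) * α ≤ innerF (X - R.Om t) (Z - X) * α :=
      mul_le_mul_of_nonneg_right (by linarith) hα.le
    have h13 := mul_nonneg hα.le h11
    have h14 : M * normF (Z - X) =
        (normF D.C + ρ) * normF (Z - X) + d * normF (Z - X) * α := by rw [hMdef]; ring
    rw [innerF_sub_right, hWF] at h4
    rw [h8, normSqF_add] at hnext
    rw [R.proxVal_eq hOm0 hρ hα t, ← hXdef, hnext]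
    linarith
  · refine (add_le_add_right (min_le_right _ _) _).trans ?_
    push Not at hcase
    have h4 : τ / (2 * M) ≤ normF (Z - X) := by
      rw [div_le_iff₀ (by linarith)]
      linarith
    have h5 : (τ / (2 * M)) ^ 2 ≤ normSqF (Z - X) := by
      rw [← normF_sq]
      exact pow_le_pow_left₀ (by positivity) h4 2
    have h6 := mul_le_mul_of_nonneg_left h5 (show 0 ≤ α / 2 by linarith)
    rw [hnext]
    rw [proxVal, ← hXdef]
    linarith

end

end Run

/-- Uniform convergence of the penalized cost over all runs. -/
theorem exists_forall_F_le (hn : 0 < n) (hS : D.Slater) {ρ : ℝ} (hρ : D.dualTraceMax < ρ)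
    (hne : D.primalOpt.Nonempty)
    {q : (Fin m → ℝ) × Matrix (Fin n) (Fin n) ℝ} (hq : q ∈ D.dualOpt)
    {rp rc : ℕ} (hrc : 0 < rc) {α β : ℝ} (hα : 0 < α) (hβ : 0 < β) (hβ1 : β < 1)
    {Om0 : Matrix (Fin n) (Fin n) ℝ} (hOm0 : Om0.IsSymm) {ε : ℝ} (hε : 0 < ε) :
    ∃ T : ℕ, 0 < T ∧ ∀ R : D.Run ρ α β rp rc Om0, ∀ t, T ≤ t →
      D.F ρ (R.Om t) ≤ D.b ⬝ᵥ q.1 + ε := by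
  have hρ0 := rho_pos hρ
  obtain ⟨Xs, hXs⟩ := hne
  set v := D.b ⬝ᵥ q.1 with hv
  have hFXs : D.F ρ Xs = v := by
    rw [F_eq_of_posSemidef hn hXs.1.2, zero_gap hn hS hXs hq]
  have hvle : ∀ X ∈ D.affineSet, v ≤ D.F ρ X := fun X hX => by
    have h1 := le_F (ρ := ρ) hX hq
    have h2 := mul_nonneg (sub_nonneg.2 (trace_lt_of_mem_dualOpt hS hρ hq).le)
      (le_max_right (lam (-X) 1) 0)
    linarith
  have hC := normF_nonneg D.C
  -- The distance bound for the first candidate, which becomes the reference point if `Om0` violates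
  -- the constraints; `L` covers both starts.
  set r := 1 + (normF D.C + ρ + α / 2 * normSqF (Xs - Om0)) / (α / 2) with hr
  have hr0 : 0 ≤ r := by
    have := normSqF_nonneg (Xs - Om0)
    positivity
  set L := max (D.F ρ Om0) (v + (normF D.C + ρ) * r) with hL
  have hvL : v ≤ L := by
    refine le_trans ?_ (le_max_right _ _)
    have : 0 ≤ (normF D.C + ρ) * r := by positivity
    linarith
  obtain ⟨B, hB0, hB⟩ := exists_normF_le hS hρ hq L
  set K := |L| + normF D.C * B with hK
  have hK0 : 0 ≤ K := by positivity
  set d := 1 + (normF D.C + K) / α with hd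
  have hd0 : 0 ≤ d := by positivity
  set U := K + normF D.C * d with hU
  have hU0 : 0 ≤ U := by positivity
  -- Chosen so that the proximal cost of moving a fraction `s` towards `Xs` is at most half of the
  -- gain `s * ε`; the other half is `c`.
  set s := min 1 (ε / (α * (2 * B) ^ 2 + 1)) with hs
  have hs0 : 0 < s := lt_min one_pos (by positivity)
  set c := s * ε / 2 with hc
  have hc0 : 0 < c := by positivity
  -- A failed descent test leaves at least the fraction `1 - β` of the predicted decrease as the
  -- model's error at the candidate.
  set τ := (1 - β) * c with hτ
  have hτ0 : 0 < τ := mul_pos (by linarith) hc0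
  set κ := min (τ / 2) (α / 2 * (τ / (2 * (normF D.C + ρ + α * d))) ^ 2) with hκ
  have hκ0 : 0 < κ := lt_min (by positivity) (by positivity)
  obtain ⟨T, hT0, hT⟩ := exists_forall_le_of_potential (L := L) (v := v) (ε := ε)
    (mul_pos hβ hc0) hκ0 hU0
  refine ⟨T, hT0, fun R => ?_⟩
  have hmono : ∀ t, 0 < t → D.F ρ (R.Om (t + 1)) ≤ D.F ρ (R.Om t) := fun t ht =>
    R.F_succ_le hOm0 hρ0 hα hβ (Or.inl ht.ne')
  have h1L : D.F ρ (R.Om 1) ≤ L := by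
    by_cases h0 : R.Om 0 ∈ D.affineSet
    · have := R.F_succ_le hOm0 hρ0 hα hβ (t := 0) (Or.inr h0)
      rw [R.Om_zero] at this
      exact this.trans (le_max_left _ _)
    · rw [R.step_affine h0]
      refine le_trans ?_ (le_max_right _ _)
      have h1 := R.normF_cand_one_sub_le hOm0 hρ0 hα hXs.1.1
      have h2 := le_of_abs_le (F_sub_le (D := D) hn hρ0.le (R.cand_mem 0).1 hXs.1.1.1)
      have h3 := mul_le_mul_of_nonneg_left h1 (show 0 ≤ normF D.C + ρ by positivity)
      rw [← hr] at h3
      rw [hFXs, zero_add] at h2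
      linarith
  have hleL : ∀ t, 0 < t → D.F ρ (R.Om t) ≤ L := fun t ht => by
    induction t, ht using Nat.le_induction with
    | base => exact h1L
    | succ t ht ih => exact (hmono t ht).trans ih
  have hmem : ∀ t, 0 < t → R.Om t ∈ D.affineSet := fun t ht => R.Om_mem (Or.inl ht.ne')
  have hpre : ∀ t, 0 < t → D.F ρ (R.Om t) - D.model ρ (R.Wbar t) (R.P t) (R.cand (t + 1)) ≤
      normF D.C * normF (R.cand (t + 1) - R.Om t) + K := fun t ht => by
    -- The zero weight shows that every model is at least `⟨C, ·⟩`, which bounds the predicted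
    -- decrease independently of the run.
    have h1 := le_model (D := D) (R.Wbar_spec t).1 (R.Wbar_spec t).2 (R.P_orthonormal t) hρ0
      (R.cand_mem t).1 (zero_mem_weightSet hρ0.le)
    rw [sub_zero] at h1
    have h2 := (abs_le.1 (abs_innerF_le D.C (R.cand (t + 1) - R.Om t))).1
    rw [innerF_sub_right] at h2
    have h3 := (abs_le.1 (abs_innerF_le D.C (R.Om t))).1
    have h4 := mul_le_mul_of_nonneg_left (hB _ (hmem t ht) (hleL t ht)) hC
    linarith [hleL t ht, le_abs_self L]
  have hdist : ∀ t, 0 < t → normF (R.cand (t + 1) - R.Om t) ≤ d := fun t ht => by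
    refine le_of_quadratic_le hα hC hK0 ?_
    rw [normF_sq]
    exact (R.step_gain hOm0 hρ0 hα (Or.inl ht.ne')).trans (hpre t ht)
  refine hT (fun t => D.F ρ (R.Om t)) R.proxVal h1L (fun t ht => hvle _ (hmem t ht)) hmono
    (fun t ht => ⟨?_, ?_⟩) fun t ht hlt => ?_
  · have := R.proxVal_le hOm0 hρ0 hα (Or.inl ht.ne') (hmem t ht) (s := 0) le_rfl zero_le_one
    simpa using this
  · rw [R.proxVal_eq hOm0 hρ0 hα]
    have h1 := hpre t ht
    have h2 := mul_le_mul_of_nonneg_left (hdist t ht) hC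
    have h3 := mul_nonneg (show 0 ≤ α / 2 by linarith)
      (normSqF_nonneg (R.cand (t + 1) - R.Om t))
    linarith
  · have hgain : c ≤ D.F ρ (R.Om t) - R.proxVal t := by
      have h1 := R.proxVal_le hOm0 hρ0 hα (Or.inl ht.ne') hXs.1.1 hs0.le (min_le_left _ _)
      have h2 : normF (Xs - R.Om t) ≤ 2 * B := by
        have h3 := normF_add_le Xs (-R.Om t)
        rw [normF_neg, ← sub_eq_add_neg] at h3
        linarith [hB _ (hmem t ht) (hleL t ht), hB _ hXs.1.1 (hFXs.le.trans hvL)]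
      have h3 : normSqF (Xs - R.Om t) ≤ (2 * B) ^ 2 := by
        rw [← normF_sq]
        exact pow_le_pow_left₀ (normF_nonneg _) h2 2
      have h4 : s * (α * (2 * B) ^ 2) ≤ ε := by
        have h5 : s ≤ ε / (α * (2 * B) ^ 2 + 1) := min_le_right _ _
        rw [le_div_iff₀ (by positivity)] at h5
        linarith
      have h5 : α / 2 * (s ^ 2 * normSqF (Xs - R.Om t)) ≤ s * ε / 2 := by
        have h6 := mul_le_mul_of_nonneg_left h3 (show 0 ≤ α / 2 * s ^ 2 by positivity)
        have h7 := mul_le_mul_of_nonneg_left h4 (show 0 ≤ s / 2 by positivity)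
        linarith
      have h6 : s * ε ≤ s * (D.F ρ (R.Om t) - D.F ρ Xs) :=
        mul_le_mul_of_nonneg_left (by rw [hFXs]; linarith) hs0.le
      rw [hc]
      linarith
    have hpm := R.proxVal_eq hOm0 hρ0 hα t
    have h0 := mul_nonneg (show 0 ≤ α / 2 by linarith)
      (normSqF_nonneg (R.cand (t + 1) - R.Om t))
    have hgain' : c ≤ D.F ρ (R.Om t) - D.model ρ (R.Wbar t) (R.P t) (R.cand (t + 1)) := by
      linarith
    by_cases hdes : R.IsDescent t
    · left
      rw [R.step_descent t (Or.inl ht.ne') hdes]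
      have h1 : _ ≤ _ := hdes
      have h2 := mul_le_mul_of_nonneg_left hgain' hβ.le
      linarith
    · right
      have hOm := R.step_null t (Or.inl ht.ne') hdes
      refine ⟨congrArg (D.F ρ) hOm,
        R.proxVal_succ_ge hOm0 hρ0 hα hrc hOm hτ0 (hdist t ht) ?_⟩
      have h1 : D.F ρ (R.Om t) - D.F ρ (R.cand (t + 1)) < _ := not_le.1 hdes
      have h2 := mul_le_mul_of_nonneg_left hgain' (show 0 ≤ 1 - β by linarith)
      linarith

end SDP
-- Models containing current eigenvectors, and persistence of descent steps.
namespace SDP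
variable {n m : ℕ} {D : SDP n m}

namespace Run
variable {ρ α β : ℝ} {rp rc : ℕ} {Om0 : Matrix (Fin n) (Fin n) ℝ}
  (R : D.Run ρ α β rp rc Om0)

/-- The reference point is feasible for the affine constraint, and the current model contains top
eigenvectors at it. -/
def IsAnchored (t : ℕ) : Prop :=
  (t ≠ 0 ∨ R.Om 0 ∈ D.affineSet) ∧ ∃ V : Matrix (Fin n) (Fin rc) ℝ,
    IsTopEigenvectors (-R.Om t) V ∧
      LinearMap.range V.mulVecLin ≤ LinearMap.range (R.P t).mulVecLin

variable {R}

theorem isAnchored_succ {t : ℕ} (h : R.Om (t + 1) = R.cand (t + 1)) : R.IsAnchored (t + 1) :=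
  ⟨Or.inl t.succ_ne_zero, R.V t, by rw [h]; exact R.V_eig t, R.P_span_current t⟩

theorem isAnchored_zero (h : R.Om 0 ∈ D.affineSet) : R.IsAnchored 0 := by
  have hP : IsTopEigenvectors (-R.Om 0) (R.P 0) := by
    rw [R.Om_zero]
    exact R.P_zero
  refine ⟨Or.inr h, _, hP.castLE (Nat.le_add_left rc rp), ?_⟩
  rw [range_mulVecLin, range_mulVecLin]
  refine Submodule.span_mono ?_
  rintro _ ⟨j, rfl⟩
  exact ⟨Fin.castLE (Nat.le_add_left rc rp) j, rfl⟩

/-- Null steps keep the reference point but may discard its eigenvectors, so one returns to the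
index at which that point was adopted. -/
theorem exists_isAnchored {t : ℕ} (ht : t ≠ 0 ∨ R.Om 0 ∈ D.affineSet) :
    ∃ s ≤ t, R.Om t = R.Om s ∧ R.IsAnchored s := by
  induction t with
  | zero => exact ⟨0, le_rfl, rfl, isAnchored_zero (by simpa using ht)⟩
  | succ t ih =>
    by_cases h : t ≠ 0 ∨ R.Om 0 ∈ D.affineSet
    · by_cases h2 : R.IsDescent t
      · exact ⟨t + 1, le_rfl, rfl, isAnchored_succ (R.step_descent t h h2)⟩
      · obtain ⟨s, hs, hOm, hanc⟩ := ih h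
        exact ⟨s, hs.trans t.le_succ, (R.step_null t h h2).trans hOm, hanc⟩
    · push Not at h
      obtain ⟨rfl, h0⟩ := h
      exact ⟨1, le_rfl, rfl, isAnchored_succ (R.step_affine h0)⟩

/-- The predicted decrease is at least `α * ‖cand - Om‖²`, so for `η ≤ α` the model error is at most
half of it, and the actual decrease is at least the other half. -/
theorem isDescent_of_quadratic_bound (hOm0 : Om0.IsSymm) (hρ : 0 < ρ) (hα : 0 < α)
    (hβ : β ≤ 1 / 2) {η : ℝ} (hη : η ≤ α) {t : ℕ} (ht : t ≠ 0 ∨ R.Om 0 ∈ D.affineSet)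
    (h : D.F ρ (R.cand (t + 1)) ≤ D.model ρ (R.Wbar t) (R.P t) (R.cand (t + 1)) +
      η / 2 * normSqF (R.cand (t + 1) - R.Om t)) : R.IsDescent t := by
  have h1 := R.step_gain hOm0 hρ hα ht
  have h2 := normSqF_nonneg (R.cand (t + 1) - R.Om t)
  have h3 := mul_le_mul_of_nonneg_right hη h2
  have h4 := (mul_nonneg hα.le h2).trans h1
  have h5 := mul_le_mul_of_nonneg_right hβ h4
  rw [IsDescent]
  linarith

/-- Anchored reference points of small penalized cost are followed by descent steps only. -/
theorem isAnchored_of_le (hOm0 : Om0.IsSymm) (hρ : 0 < ρ) (hα : 0 < α) (hβ0 : 0 < β)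
    (hβ : β ≤ 1 / 2) {η : ℝ} (hη : η ≤ α) {c : ℝ}
    (hquad : ∀ t, R.IsAnchored t → D.F ρ (R.Om t) ≤ c → ∀ X ∈ D.affineSet,
      D.F ρ X ≤ D.model ρ (R.Wbar t) (R.P t) X + η / 2 * normSqF (X - R.Om t))
    {t : ℕ} (ht : t ≠ 0 ∨ R.Om 0 ∈ D.affineSet) (hc : D.F ρ (R.Om t) ≤ c) : R.IsAnchored t := by
  obtain ⟨s, hs, hOm, hanc⟩ := exists_isAnchored ht
  -- The index `s` may be small, but the induction needs only the cost there, which equals the cost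
  -- at `t`.
  have hcs : D.F ρ (R.Om s) ≤ c := by rwa [← hOm]
  suffices h : R.IsAnchored t ∧ D.F ρ (R.Om t) ≤ c from h.1
  clear hOm hc ht
  induction t, hs using Nat.le_induction with
  | base => exact ⟨hanc, hcs⟩
  | succ t hs ih =>
    obtain ⟨h1, h2⟩ := ih
    have h3 := isDescent_of_quadratic_bound hOm0 hρ hα hβ hη h1.1
      (hquad t h1 h2 _ (R.cand_mem t))
    exact ⟨isAnchored_succ (R.step_descent t h1.1 h3),
      (R.F_succ_le hOm0 hρ hα hβ0 h1.1).trans h2⟩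

/-- Quadratic closeness of the model at anchored points near an optimal solution. -/
theorem quadratic_bound_of_near (hρ : 0 < ρ) (hrc : 0 < rc) (hrcn : rc < n) (hσ : D.sigmaP ≤ rc)
    {g : ℝ} (hg : 0 < g) {t : ℕ} (hanc : R.IsAnchored t) {Xs : Matrix (Fin n) (Fin n) ℝ}
    (hXs : Xs ∈ D.affineSet) (hgap : lam (-Xs) (D.sigmaP + 1) ≤ max (lam (-Xs) 1) 0 - g)
    (hnear : normF (R.Om t - Xs) < g / 6) {X : Matrix (Fin n) (Fin n) ℝ} (hX : X ∈ D.affineSet) :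
    D.F ρ X ≤ D.model ρ (R.Wbar t) (R.P t) X + 12 * ρ / g / 2 * normSqF (X - R.Om t) := by
  obtain ⟨ht, V, hV, hVP⟩ := hanc
  have hOm := (R.Om_mem ht).1
  have h1 := lam_antitone hOm.neg hσ hrcn
  have h2 := lam_le_add hOm.neg hXs.1.neg (lt_of_le_of_lt hσ hrcn)
  rw [show -R.Om t - -Xs = -(R.Om t - Xs) by abel, normF_neg] at h2
  have h3 := (abs_le.1 (abs_posPart_lam_sub_le hOm hXs.1 (by omega))).1
  -- The two quantities in `hgap` each move by less than `g / 6`, leaving `2 / 3 * g`, which yields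
  -- the constant `12 * ρ / g`.
  have h4 := F_le_model_add (D := D) (R.Wbar_spec t).1 (R.Wbar_spec t).2 (R.P_orthonormal t) hρ hrc
    hrcn hOm hX.1 hV hVP (g := 2 / 3 * g) (by positivity) (by linarith)
  have h5 : ρ * (4 / (2 / 3 * g)) = 12 * ρ / g / 2 := by field_simp; norm_num
  rwa [h5] at h4

end Run

/-- The second entry of the maximum suffices, since `3 ≤ 9 * (8 * √2 + 16)`; the larger prescribed
constant only weakens the bound. -/
theorem le_etaConst {ρ : ℝ} (hρ : 0 < ρ) (hgap : 0 < D.gap) : 12 * ρ / D.gap ≤ D.etaConst ρ := by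
  have h1 := le_max_right (144 * D.primalOpMax / D.gap ^ 2)
    (9 * (8 * Real.sqrt 2 + 16) / D.gap)
  have h2 : 3 / D.gap ≤ 9 * (8 * Real.sqrt 2 + 16) / D.gap := by
    gcongr
    linarith [Real.sqrt_nonneg 2]
  have h3 := mul_le_mul_of_nonneg_left (h2.trans h1) (show 0 ≤ 4 * ρ by positivity)
  refine le_trans (le_of_eq ?_) h3
  ring

/-- A uniform separation constant on the set of optimal solutions. -/
theorem exists_uniform_gap (hσ : D.sigmaP < n) (hS : D.Slater) {ρ : ℝ}
    (hρ : D.dualTraceMax < ρ) (hne : D.primalOpt.Nonempty)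
    {q : (Fin m → ℝ) × Matrix (Fin n) (Fin n) ℝ} (hq : q ∈ D.dualOpt) :
    ∃ g, 0 < g ∧ (0 < D.gap → g = D.gap) ∧
      ∀ X ∈ D.primalOpt, lam (-X) (D.sigmaP + 1) ≤ max (lam (-X) 1) 0 - g := by
  by_cases hgap : 0 < D.gap
  · exact ⟨D.gap, hgap, fun _ => rfl, fun X hX => lam_sigmaP_le_of_gap_pos hσ hgap hX⟩
  · obtain ⟨g, hg, hgX⟩ := exists_gap_pos hσ hS hρ hne hq
    exact ⟨g, hg, fun h => absurd h hgap, fun X hX => by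
      linarith [hgX X hX, le_max_right (lam (-X) 1) 0]⟩

theorem exists_eta {ρ g : ℝ} (hρ : 0 < ρ) (hg : 0 < g) (hgap : 0 < D.gap → g = D.gap) :
    ∃ η, 0 < η ∧ 12 * ρ / g ≤ η ∧ (0 < D.gap → η = D.etaConst ρ) := by
  have hpos : 0 < 12 * ρ / g := by positivity
  by_cases h : 0 < D.gap
  · have h1 := le_etaConst hρ h
    rw [← hgap h] at h1
    exact ⟨D.etaConst ρ, hpos.trans_le h1, h1, fun _ => rfl⟩
  · exact ⟨_, hpos, le_rfl, fun h' => absurd h' h⟩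

end SDP
end SBMP

/-! ### Assembly of the theorem. -/

theorem mainTheorem8 {n m : ℕ} (D : SBMP.SDP n m)
    (hA : LinearIndependent ℝ D.A) (hSlater : D.Slater) (hsc : D.StrictComplementarity)
    (ρ : ℝ) (hρ : D.dualTraceMax < ρ) :
    ∃ η : ℝ, 0 < η ∧
      (D.C ∉ Submodule.span ℝ (Set.range D.A) → D.sigmaP < n → 0 < D.gap) ∧
      (0 < D.gap → η = D.etaConst ρ) ∧
      ∀ rp rc : ℕ, 1 ≤ rc → rp + rc < n → D.sigmaP ≤ rc →
      ∀ α β : ℝ, 0 < α → 0 < β → β < 1 →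
      ∀ Om0 : Matrix (Fin n) (Fin n) ℝ, Om0.IsSymm →
      ∃ T0 : ℕ, 0 < T0 ∧ ∀ R : D.Run ρ α β rp rc Om0, ∀ t : ℕ, T0 ≤ t →
        (0 < D.gap → ∃ Xs ∈ D.primalOpt, SBMP.opNorm (R.Om t - Xs) ≤ D.gap / 3) ∧
        (∀ X ∈ D.affineSet, D.model ρ (R.Wbar t) (R.P t) X ≤ D.F ρ X) ∧
        ((R.Om t = R.cand t ∨ (η ≤ α ∧ β ≤ 1 / 2)) →
          ∀ X ∈ D.affineSet,
            D.F ρ X ≤ D.model ρ (R.Wbar t) (R.P t) X + η / 2 * SBMP.normSqF (X - R.Om t)) := by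
  have hρ0 := SBMP.SDP.rho_pos hρ
  by_cases hσ : D.sigmaP < n
  swap
  -- If `σ_p ≥ n`, no `rc` meets both `σ_p ≤ rc` and `rp + rc < n`, so only the prescribed value of
  -- `η` matters.
  · obtain ⟨η, hη, -, hηgap⟩ := SBMP.SDP.exists_eta (D := D) (g := if 0 < D.gap then D.gap else 1)
      hρ0 (by split_ifs with h <;> [exact h; exact one_pos]) fun h => if_pos h
    exact ⟨η, hη, fun _ h => absurd h hσ, hηgap, fun rp rc _ h1 h2 => by omega⟩
  obtain ⟨X₀, hX₀, q, hq, -⟩ := id hsc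
  have hne : D.primalOpt.Nonempty := ⟨X₀, hX₀⟩
  have hn : 0 < n := by omega
  obtain ⟨g, hg, hgap, hgP⟩ := SBMP.SDP.exists_uniform_gap hσ hSlater hρ hne hq
  obtain ⟨η, hη, hgη, hηgap⟩ := SBMP.SDP.exists_eta hρ0 hg hgap
  refine ⟨η, hη, SBMP.SDP.gap_pos hsc hSlater hρ, hηgap, ?_⟩
  intro rp rc hrc hrn hσrc α β hα hβ hβ1 Om0 hOm0
  -- The Frobenius radius `g / 6` serves the quadratic bound and is also below `D.gap / 3`.
  obtain ⟨ε, hε, hnear⟩ := SBMP.SDP.exists_forall_near_primalOpt hn hSlater hρ hne hq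
    (show 0 < g / 6 by positivity)
  obtain ⟨T, hT, hconv⟩ := SBMP.SDP.exists_forall_F_le (rp := rp) hn hSlater hρ hne hq hrc hα hβ hβ1
    hOm0 hε
  refine ⟨T, hT, fun R t ht => ?_⟩
  have hF := hconv R t ht
  have ht0 : t ≠ 0 ∨ R.Om 0 ∈ D.affineSet := Or.inl (by omega)
  have hquad : ∀ t, R.IsAnchored t → D.F ρ (R.Om t) ≤ D.b ⬝ᵥ q.1 + ε → ∀ X ∈ D.affineSet,
      D.F ρ X ≤ D.model ρ (R.Wbar t) (R.P t) X + η / 2 * SBMP.normSqF (X - R.Om t) := by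
    intro t hanc hFt X hX
    obtain ⟨Xs, hXs, hd⟩ := hnear _ (R.Om_mem hanc.1) hFt
    refine (SBMP.SDP.Run.quadratic_bound_of_near hρ0 hrc (by omega) hσrc hg hanc hXs.1.1
      (hgP Xs hXs) hd hX).trans ?_
    have := mul_le_mul_of_nonneg_right hgη (SBMP.normSqF_nonneg (X - R.Om t))
    linarith
  refine ⟨fun h => ?_, fun X hX => R.model_le_F hρ0 t hX.1, fun h => hquad t ?_ hF⟩
  · obtain ⟨Xs, hXs, hd⟩ := hnear _ (R.Om_mem ht0) hF
    refine ⟨Xs, hXs, (SBMP.opNorm_le_normF _).trans ?_⟩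
    rw [← hgap h]
    linarith
  · rcases h with h | ⟨hηα, hβ2⟩
    · obtain ⟨k, rfl⟩ : ∃ k, t = k + 1 := ⟨t - 1, by omega⟩
      exact SBMP.SDP.Run.isAnchored_succ h
    · exact SBMP.SDP.Run.isAnchored_of_le hOm0 hρ0 hα hβ hβ2 hηα hquad ht0 hF
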